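/- **Theorem (Block-encoding of two-level Additive Schwarz with BPX local solvers).** For every dimension $d\ge 1$ there is a constant $C_d$, depending only on $d$, such that the following holds. *Geometry.* Let $L\ge 1$, let $N_1,\dots,N_d\ge 1$, $N=\prod_s N_s$, and let $0<2\delta<1$ with $2\delta/2^{-L}$ an integer. Let $\Omega=\prod_{s=1}^d[0,\,N_s-2\delta(N_s-1)]$, with its Cartesian mesh $\mathcal T_L$ of mesh size $2^{-L}$, and let $\Omega^{(i)}$, $i=(i_1,\dots,i_d)$ with $0\le i_s<N_s$, be the $N$ unit cubes $\prod_s\big(i_s(1-2\delta),\,i_s(1-2\delta)+1\big)$. Let $V_L$ be the $\mathbb Q_1$ finite element space on $\mathcal T_L$ with zero boundary values and $(\phi_v)$ its nodal basis, indexed by the $\mathcal N$ interior vertices. *Matrices.* Let $\rho$ be a diffusion coefficient with values in the symmetric positive definite $d\times d$ matrices on every element $K\in\mathcal T_L$, equal to a constant $\rho_{|K}$ there. Put $A_{vw}=\int_\Omega\rho\,\nabla\phi_v\cdot\nabla\phi_w$, and let $D_\rho$ be the block-diagonal matrix with the blocks $\rho_{|K}$. Let $C_L$ be the matrix of the elementwise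 gradient from $V_L$, with its nodal basis, into $Q_L\otimes\mathbb R^d$, where $Q_L$ is the discontinuous piecewise $\mathbb Q_1$ space on $\mathcal T_L$ and $Q_L\otimes\mathbb R^d$ carries the basis $\psi_{K,k}\otimes e_s$; here $\psi_{K,1},\dots,\psi_{K,2^d}$ is an $L^2$-orthonormal basis of $\mathbb Q_1(K)$ for each $K$, and $e_s$ are the unit vectors of $\mathbb R^d$. Let $R_L^{(i)}$ consist of the rows of $I_{\mathcal N}$ that belong to the interior vertices of $\Omega^{(i)}$. *Preconditioner.* In each subdomain use the BPX factor $$F^{(i)}=\big(2^{-(2-d)/2}\mathcal I_{1,L}\,|\,\cdots\,|\,2^{-l(2-d)/2}\mathcal I_{l,L}\,|\,\cdots\,|\,2^{-L(2-d)/2}\mathcal I_{L,L}\big),$$ where $\mathcal I_{l,L}$ is the matrix, in the nodal bases, of the embedding $V_l^{(i)}\hookrightarrow V_L^{(i)}$ of the $\mathbb Q_1$ spaces with zero boundary values on the Cartesian meshes of $\Omega^{(i)}$ of sizes $2^{-l}$ and $2^{-L}$. Let $Z$ be a real matrix with $\mathcal N$ rows and at least one column, whose columns are linearly independent (a basis of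 the coarse space), let $F^{(0)}$ be a real, possibly rectangular, matrix with $(Z^\top AZ)^{-1}=F^{(0)}{F^{(0)}}^\top$, and let $$\tilde F=\big({R_L^{(1)}}^\top F^{(1)}\,|\,\cdots\,|\,{R_L^{(N)}}^\top F^{(N)}\,|\,ZF^{(0)}\big).$$ *Block-encodings.* A block-encoding $U_{\mathcal A}$ of $\mathcal A\in\mathbb C^{M_1\times M_2}$ consists of a unitary $U\in\mathbb C^{2^p\times 2^p}$, matrices $\Pi_{M_j}\in\mathbb C^{M_j\times 2^p}$ ($j=1,2$) with orthonormal rows, together with the gates $\Pi_{M_j}^\dagger\Pi_{M_j}\otimes X+(I-\Pi_{M_j}^\dagger\Pi_{M_j})\otimes I$, and a normalization factor $\alpha(U_{\mathcal A})\ge\|\mathcal A\|$ with $\mathcal A=\alpha(U_{\mathcal A})\,\Pi_{M_1}U\,\Pi_{M_2}^\dagger$. Its subnormalization factor is $\tilde\alpha(U_{\mathcal A})=\alpha(U_{\mathcal A})/\|\mathcal A\|$. Here $\|\cdot\|$ is the spectral norm, and $\kappa(D_\rho)=\|D_\rho\|\,\|D_\rho^{-1}\|$. *Claim.* For every block-encoding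 $U_{D_\rho}$ of $D_\rho$ and every block-encoding $U_{C_LZF^{(0)}}$ of $C_LZF^{(0)}$ there exists a block-encoding $U_{\tilde F^\top A\tilde F}$ of $\tilde F^\top A\tilde F$ with normalization factor $$\alpha(U_{\tilde F^\top A\tilde F})=\alpha(U_{D_\rho})\left(4NdL+\alpha\big(U_{C_LZF^{(0)}}\big)^2\right)$$ and subnormalization factor $$\tilde\alpha(U_{\tilde F^\top A\tilde F})\le\kappa(D_\rho)\,\tilde\alpha(U_{D_\rho})\left(Nd(L+C_d)+\tilde\alpha\big(U_{C_LZF^{(0)}}\big)^2\right).$$ -/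

import Mathlib

open scoped Matrix Matrix.Norms.L2Operator Kronecker
open MeasureTheory

noncomputable section

/-! ### Block-encodings -/

/-- The gate `C_Π NOT = Π† Π ⊗ X + (1 - Π† Π) ⊗ 1` of a matrix `Π` with orthonormal rows. -/
def projNOT {m P : Type*} [Fintype m] [DecidableEq P] (Pi : Matrix m P ℂ) :
    Matrix (P × Fin 2) (P × Fin 2) ℂ :=
  (Piᴴ * Pi) ⊗ₖ !![0, 1; 1, 0] + (1 - Piᴴ * Pi) ⊗ₖ (1 : Matrix (Fin 2) (Fin 2) ℂ)

/-- A block-encoding of the rectangular matrix `M` (also known as a projected unitary encoding):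
a unitary `U` of order `2 ^ p`, two matrices with orthonormal rows and their controlled-NOT gates,
and a normalization factor `α ≥ ‖M‖` such that `M = α Π₁ U Π₂†`. The norm is the spectral norm. -/
structure BlockEncoding {m n : Type*} [Fintype m] [DecidableEq m] [Fintype n] [DecidableEq n]
    (M : Matrix m n ℂ) where
  /-- the number of qubits -/
  p : ℕ
  /-- the encoding matrix -/
  U : Matrix (Fin (2 ^ p)) (Fin (2 ^ p)) ℂ
  /-- the normalization factor -/
  α : ℝ
  /-- the row projection -/
  rowProj : Matrix m (Fin (2 ^ p)) ℂ
  /-- the column projection -/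
  colProj : Matrix n (Fin (2 ^ p)) ℂ
  /-- the gate that implements the row projection -/
  rowNOT : Matrix (Fin (2 ^ p) × Fin 2) (Fin (2 ^ p) × Fin 2) ℂ
  /-- the gate that implements the column projection -/
  colNOT : Matrix (Fin (2 ^ p) × Fin 2) (Fin (2 ^ p) × Fin 2) ℂ
  unitary : U ∈ Matrix.unitaryGroup (Fin (2 ^ p)) ℂ
  rowProj_orthonormal : rowProj * rowProjᴴ = 1
  colProj_orthonormal : colProj * colProjᴴ = 1
  rowNOT_eq : rowNOT = projNOT rowProj
  colNOT_eq : colNOT = projNOT colProj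
  norm_le : ‖M‖ ≤ α
  encodes : M = (α : ℂ) • (rowProj * U * colProjᴴ)

/-- The subnormalization factor `α / ‖M‖` of a block-encoding of `M`. -/
def BlockEncoding.subnorm {m n : Type*} [Fintype m] [DecidableEq m] [Fintype n] [DecidableEq n]
    {M : Matrix m n ℂ} (E : BlockEncoding M) : ℝ :=
  E.α / ‖M‖

/-- A real matrix seen as a complex matrix. -/
def toC {m n : Type*} (M : Matrix m n ℝ) : Matrix m n ℂ := M.map Complex.ofReal

/-- The spectral condition number of a nonsingular matrix. -/
def condNumber {n : Type*} [Fintype n] [DecidableEq n] (M : Matrix n n ℂ) : ℝ :=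
  ‖M‖ * ‖M⁻¹‖

/-! ### Finite elements on Cartesian grids -/

/-- The one-dimensional hat function. -/
def hat (t : ℝ) : ℝ := max 0 (1 - |t|)

/-- The `d`-linear nodal function, on the grid of mesh size `2 ^ (-l)`, of the vertex `2 ^ (-l) c`:
it is continuous, `d`-linear on each mesh element, equal to 1 at this vertex and to 0 at all the
others. -/
def nodalFun {d : ℕ} (l : ℕ) (c : Fin d → ℕ) (x : Fin d → ℝ) : ℝ :=
  ∏ s, hat (2 ^ l * x s - c s)

/-- The gradient, through the partial derivatives. For the finite element functions it is
meaningful outside the (null) union of the element boundaries. -/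
def grad {d : ℕ} (f : (Fin d → ℝ) → ℝ) (x : Fin d → ℝ) : Fin d → ℝ :=
  fun s => lineDeriv ℝ f x (Pi.single s 1)

/-- The space `ℚ₁` spanned by the monomials of degree at most 1 in each variable. -/
def QOne (d : ℕ) : Submodule ℝ ((Fin d → ℝ) → ℝ) :=
  Submodule.span ℝ (Set.range fun (S : Finset (Fin d)) (x : Fin d → ℝ) => ∏ s ∈ S, x s)

/-! ### The BPX factor on the unit cube -/

/-- The interior vertices `2 ^ (-l) (w + 1)` of the grid of mesh size `2 ^ (-l)` of the unit
cube. -/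
abbrev CubeVertex (d l : ℕ) : Type := Fin d → Fin (2 ^ l - 1)

/-- The columns of the BPX factor: a level `l + 1` in `{1, …, L}` with an interior vertex of the
grid of this level. -/
abbrev BPXIndex (d L : ℕ) : Type := Σ l : Fin L, CubeVertex d (l + 1)

/-- The matrix, in the nodal bases, of the embedding of the finite element space of level `l` on
the unit cube (with zero boundary values) into the one of level `L`: its columns hold the values
of the nodal functions of level `l` at the interior vertices of level `L`. -/
def levelEmbedding (d l L : ℕ) : Matrix (CubeVertex d L) (CubeVertex d l) ℝ :=
  Matrix.of fun w j =>
    nodalFun l (fun s => (j s : ℕ) + 1) (fun s => ((w s : ℝ) + 1) / 2 ^ L)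

/-- The BPX factor `(2 ^ (-(2-d)/2) I_{1,L} | ⋯ | 2 ^ (-L(2-d)/2) I_{L,L})`. -/
def bpxFactor (d L : ℕ) : Matrix (CubeVertex d L) (BPXIndex d L) ℝ :=
  Matrix.of fun w c =>
    (2 : ℝ) ^ (-(((c.1 : ℕ) + 1 : ℕ) : ℝ) * (2 - (d : ℝ)) / 2) *
      levelEmbedding d (c.1 + 1) L w c.2

/-! ### The geometry of the domain decomposition -/

/-- A Cartesian family of overlapping unit cubes in dimension `d`: `N s` of them in direction `s`,
meshed with mesh size `2 ^ (-L)`, neighbours overlapping by `m = 2 δ / 2 ^ (-L)` elements. -/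
structure DDGeometry (d : ℕ) where
  L : ℕ
  N : Fin d → ℕ
  m : ℕ
  one_le_L : 1 ≤ L
  one_le_N : ∀ s, 1 ≤ N s
  m_pos : 0 < m
  m_lt : m < 2 ^ L

namespace DDGeometry

variable {d : ℕ} (G : DDGeometry d)

/-- The overlap parameter `δ`. -/
def δ : ℝ := (G.m : ℝ) / 2 / 2 ^ G.L

/-- The total number of subdomains. -/
def numSub : ℕ := ∏ s, G.N s

/-- The number of mesh elements of the domain in direction `s`. -/
def cells (s : Fin d) : ℕ := 2 ^ G.L + (G.N s - 1) * (2 ^ G.L - G.m)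

/-- The side lengths of the domain are `N s - 2 δ (N s - 1)`. -/
theorem cells_div (s : Fin d) :
    (G.cells s : ℝ) / 2 ^ G.L = G.N s - 2 * G.δ * (G.N s - 1) := by
  have h1 := G.one_le_N s
  have h2 := G.m_lt.le
  unfold cells δ
  push_cast [h1, h2]
  field_simp
  ring

/-- The domain. -/
def Ω : Set (Fin d → ℝ) :=
  Set.pi Set.univ fun s => Set.Icc 0 (G.N s - 2 * G.δ * (G.N s - 1))

/-- The interior vertices `2 ^ (-L) (v + 1)` of the mesh of the domain. -/
abbrev Vertex : Type := (s : Fin d) → Fin (G.cells s - 1)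

/-- The mesh elements. -/
abbrev Cell : Type := (s : Fin d) → Fin (G.cells s)

/-- The subdomains: `i` stands for the cube
`∏ s, (i s * (1 - 2 * δ), i s * (1 - 2 * δ) + 1)`. -/
abbrev Sub : Type := (s : Fin d) → Fin (G.N s)

/-- The (open) mesh element with index `K`. -/
def cellSet (K : G.Cell) : Set (Fin d → ℝ) :=
  Set.pi Set.univ fun s => Set.Ioo ((K s : ℝ) / 2 ^ G.L) (((K s : ℝ) + 1) / 2 ^ G.L)

/-- The nodal basis of the finite element space on the domain. -/
def φ (v : G.Vertex) : (Fin d → ℝ) → ℝ := nodalFun G.L fun s => (v s : ℕ) + 1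

/-- The stiffness matrix of the diffusion coefficient `ρ`. -/
def stiffness (ρ : (Fin d → ℝ) → Matrix (Fin d) (Fin d) ℝ) : Matrix G.Vertex G.Vertex ℝ :=
  Matrix.of fun v w => ∫ x in G.Ω, (ρ x *ᵥ grad (G.φ v) x) ⬝ᵥ grad (G.φ w) x

/-- The restrictions of `ψ K 0, …, ψ K (2 ^ d - 1)` to the element `K` form an `L²(K)`-orthonormal
basis of `ℚ₁(K)`, for every element `K`. -/
structure IsDGBasis (ψ : G.Cell → Fin (2 ^ d) → (Fin d → ℝ) → ℝ) : Prop where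
  span_eq : ∀ K, Submodule.span ℝ (Set.range (ψ K)) = QOne d
  orthonormal : ∀ K k k', ∫ x in G.cellSet K, ψ K k x * ψ K k' x = if k = k' then 1 else 0

/-- The matrix `C_L` of the elementwise gradient from the finite element space to the
`d`-vector-valued discontinuous `ℚ₁` space with the `L²`-orthonormal basis `ψ_{K,k} ⊗ e_s`:
its entries are the `L²` inner products of the gradients of the nodal functions with these basis
functions. Rows are indexed by `((s, K), k)`. -/
def gradMatrix (ψ : G.Cell → Fin (2 ^ d) → (Fin d → ℝ) → ℝ) :
    Matrix ((Fin d × G.Cell) × Fin (2 ^ d)) G.Vertex ℝ :=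
  Matrix.of fun r v => ∫ x in G.cellSet r.1.2, grad (G.φ v) x r.1.1 * ψ r.1.2 r.2 x

/-- The block-diagonal matrix `D_ρ`, with one block `ρK K` for each element `K`. -/
def coeffMatrix (ρK : G.Cell → Matrix (Fin d) (Fin d) ℝ) :
    Matrix (Fin d × G.Cell) (Fin d × G.Cell) ℝ :=
  Matrix.blockDiagonal ρK

theorem embed_lt (i : G.Sub) (w : CubeVertex d G.L) (s : Fin d) :
    (i s : ℕ) * (2 ^ G.L - G.m) + w s < G.cells s - 1 := by
  have h1 := (w s).2
  have h2 : (i s : ℕ) ≤ G.N s - 1 := by have := (i s).2; omega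
  have h3 := Nat.mul_le_mul_right (2 ^ G.L - G.m) h2
  unfold cells
  omega

/-- The interior vertex of the domain that is the interior vertex `w` of the subdomain `i`. -/
def embed (i : G.Sub) (w : CubeVertex d G.L) : G.Vertex :=
  fun s => ⟨(i s : ℕ) * (2 ^ G.L - G.m) + w s, G.embed_lt i w s⟩

/-- The restriction matrix of the subdomain `i`: the rows of the identity matrix that belong to
the interior vertices of this subdomain. -/
def restriction (i : G.Sub) : Matrix (CubeVertex d G.L) G.Vertex ℝ :=
  (1 : Matrix G.Vertex G.Vertex ℝ).submatrix (G.embed i) id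

/-- The factor `(R₁ᵀ F₁ | ⋯ | R_Nᵀ F_N | Z F₀)` of the two-level additive Schwarz preconditioner
with BPX local solvers. -/
def schwarzFactor {k q : ℕ} (Z : Matrix G.Vertex (Fin k) ℝ) (F₀ : Matrix (Fin k) (Fin q) ℝ) :
    Matrix G.Vertex ((G.Sub × BPXIndex d G.L) ⊕ Fin q) ℝ :=
  Matrix.fromCols
    (Matrix.of fun v c => ((G.restriction c.1)ᵀ * bpxFactor d G.L) v c.2)
    (Z * F₀)

end DDGeometry

end

/-!
Let `D = D_ρ`, `C = C_L`, `F` the Schwarz factor. Since `ρ` is constant on the elements and the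
gradient of a `ℚ₁` function is elementwise `ℚ₁`, the stiffness matrix factors as
`A = Cᵀ (D ⊗ 1) C`. Hence `‖Fᵀ A F‖` lies between `‖C F‖² / ‖D⁻¹‖` and `‖D‖ ‖C F‖²`, and only
`‖C F‖` has to be estimated.

The BPX scaling gives every scaled nodal function a gradient bounded independently of its level. In
each direction, on each level and in each subdomain, the derivative of a hat function splits a
sequence of coefficients into differences over disjoint dyadic intervals, which bounds the local
part of `‖C F‖²` by `4 N d L`. The coarse part of `C F` contributes at most `‖C Z F⁽⁰⁾‖²`.

For the lower bound on `‖C F‖²`, one test function suffices: a product of sawtooth functions of the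
finest level in one subdomain, whose coefficients are `±1`. Together with `‖C Z F⁽⁰⁾‖ ≤ ‖C F‖` this
bounds the subnormalization factor, with `C_d = 2 ^ d`.

Finally, a Hermitian contraction `T` is the average of a unitary `u` and its adjoint, so
`[[T, Q], [Q, T]]` with `Q = (u - u*) / 2` is unitary. A Hermitian matrix therefore has a
block-encoding with every normalization factor that is at least its norm.
-/

noncomputable section

/-! ### Linear splines -/

theorem hat_nonneg (t : ℝ) : 0 ≤ hat t := le_max_left _ _

theorem hat_of_one_le_abs {t : ℝ} (h : 1 ≤ |t|) : hat t = 0 := max_eq_left (by linarith)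

theorem hat_of_abs_le_one {t : ℝ} (h : |t| ≤ 1) : hat t = 1 - |t| := max_eq_right (by linarith)

theorem hat_pos_iff {t : ℝ} : 0 < hat t ↔ |t| < 1 := by simp [hat]

theorem continuous_hat : Continuous hat := by unfold hat; fun_prop

theorem hat_intCast (z : ℤ) : hat z = if z = 0 then 1 else 0 := by
  split_ifs with h
  · simp [h, hat]
  · exact hat_of_one_le_abs (by exact_mod_cast Int.one_le_abs h)

theorem sum_hat_intCast_sub_le_one {ι : Type*} [Fintype ι] {c : ι → ℤ}
    (hc : Function.Injective c) (z : ℤ) : ∑ j, hat ((z : ℝ) - c j) ≤ 1 := by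
  have hsub : ∀ j, hat ((z : ℝ) - c j) = if c j = z then 1 else 0 := fun j => by
    rw [← Int.cast_sub, hat_intCast]
    exact if_congr (by rw [sub_eq_zero, eq_comm]) rfl rfl
  simp only [hsub, Finset.sum_boole]
  exact_mod_cast Finset.card_le_one.2 fun a ha b hb =>
    hc (by rw [(Finset.mem_filter.1 ha).2, (Finset.mem_filter.1 hb).2])

/-- The linear splines with knots at the integer multiples of `1 / n`: the functions that are
affine between consecutive knots. -/
def IsLinearSpline (n : ℝ) (f : ℝ → ℝ) : Prop :=
  ∀ k : ℤ, ∀ y ∈ Set.Icc (k / n) ((k + 1) / n),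
    f y = f (k / n) * (k + 1 - n * y) + f ((k + 1) / n) * (n * y - k)

theorem isLinearSpline_one_hat : IsLinearSpline 1 hat := by
  rintro k t ⟨h₀, h₁⟩
  simp only [div_one, one_mul] at h₀ h₁ ⊢
  obtain h | rfl | rfl | h : k ≤ -2 ∨ k = -1 ∨ k = 0 ∨ 1 ≤ k := by omega
  · have h' : (k : ℝ) ≤ -2 := by exact_mod_cast h
    rw [hat_of_one_le_abs (t := t) (le_abs.2 (.inr (by linarith))),
      hat_of_one_le_abs (t := k) (le_abs.2 (.inr (by linarith))),
      hat_of_one_le_abs (t := k + 1) (le_abs.2 (.inr (by linarith)))]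
    ring
  · push_cast at h₀ h₁ ⊢
    rw [hat_of_abs_le_one (abs_le.2 ⟨h₀, by linarith⟩), abs_of_nonpos (by linarith)]
    norm_num [hat, add_comm]
  · push_cast at h₀ h₁ ⊢
    rw [hat_of_abs_le_one (abs_le.2 ⟨by linarith, by linarith⟩), abs_of_nonneg h₀]
    norm_num [hat]
  · have h' : (1 : ℝ) ≤ k := by exact_mod_cast h
    rw [hat_of_one_le_abs (t := t) (le_abs.2 (.inl (by linarith))),
      hat_of_one_le_abs (t := k) (le_abs.2 (.inl (by linarith))),
      hat_of_one_le_abs (t := k + 1) (le_abs.2 (.inl (by linarith)))]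
    ring

namespace IsLinearSpline

variable {n : ℝ} {f g : ℝ → ℝ}

theorem comp_mul_sub_intCast (hn : 0 < n) (hf : IsLinearSpline 1 f) (c : ℤ) :
    IsLinearSpline n fun y => f (n * y - c) := by
  rintro k y ⟨h₀, h₁⟩
  rw [div_le_iff₀' hn] at h₀
  rw [le_div_iff₀' hn] at h₁
  have := hf (k - c) (n * y - c) ⟨by push_cast; linarith, by push_cast; linarith⟩
  push_cast at this
  simp only [this, mul_div_cancel₀ _ hn.ne', div_one, one_mul, sub_add_eq_add_sub]
  ring

theorem comp_sub_knot (hn : 0 < n) (hf : IsLinearSpline n f) (c : ℤ) :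
    IsLinearSpline n fun y => f (y - c / n) := by
  rintro k y ⟨h₀, h₁⟩
  have hk : ((k - c : ℤ) : ℝ) / n = k / n - c / n := by push_cast; ring
  have hk' : (((k - c : ℤ) : ℝ) + 1) / n = (k + 1) / n - c / n := by push_cast; ring
  have := hf (k - c) (y - c / n) ⟨by linarith, by linarith⟩
  rw [hk, hk'] at this
  simp only [this, Int.cast_sub]
  field_simp
  ring

theorem refine {r : ℕ} (hn : 0 < n) (hr : 0 < r) (hf : IsLinearSpline n f) :
    IsLinearSpline (n * r) f := by
  rintro k y ⟨h₀, h₁⟩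
  have hr' : (0 : ℝ) < r := by exact_mod_cast hr
  have hnr : 0 < n * r := mul_pos hn hr'
  set e : ℤ := k / r
  have he : (e : ℝ) * r ≤ k := by exact_mod_cast Int.ediv_mul_le k (by positivity)
  have he' : (k : ℝ) + 1 ≤ (e + 1) * r := by
    exact_mod_cast Int.lt_ediv_add_one_mul_self k (by positivity : 0 < (r : ℤ))
  have affine : ∀ x, (k : ℝ) ≤ n * r * x → n * r * x ≤ k + 1 →
      f x = f (e / n) * (e + 1 - n * x) + f ((e + 1) / n) * (n * x - e) := fun x hx hx' =>
    hf e x ⟨by rw [div_le_iff₀' hn]; nlinarith, by rw [le_div_iff₀' hn]; nlinarith⟩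
  rw [div_le_iff₀' hnr] at h₀
  rw [le_div_iff₀' hnr] at h₁
  rw [affine y h₀ h₁, affine (k / (n * r)) (by rw [mul_div_cancel₀ _ hnr.ne'])
      (by rw [mul_div_cancel₀ _ hnr.ne']; linarith),
    affine ((k + 1) / (n * r)) (by rw [mul_div_cancel₀ _ hnr.ne']; linarith)
      (by rw [mul_div_cancel₀ _ hnr.ne'])]
  field_simp
  ring

theorem sum_const_mul {ι : Type*} [Fintype ι] {F : ι → ℝ → ℝ} (a : ι → ℝ)
    (hF : ∀ j, IsLinearSpline n (F j)) : IsLinearSpline n fun y => ∑ j, a j * F j y := by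
  intro k y hy
  simp only [fun j => hF j k y hy, Finset.sum_mul, ← Finset.sum_add_distrib]
  exact Finset.sum_congr rfl fun j _ => by ring

theorem eq_of_eq_on_knots (hn : 0 < n) (hf : IsLinearSpline n f) (hg : IsLinearSpline n g)
    (hfg : ∀ k : ℤ, f (k / n) = g (k / n)) : f = g := by
  funext y
  have hy : y ∈ Set.Icc (⌊n * y⌋ / n) ((⌊n * y⌋ + 1) / n) :=
    ⟨by rw [div_le_iff₀' hn]; exact Int.floor_le _,
      by rw [le_div_iff₀' hn]; exact (Int.lt_floor_add_one _).le⟩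
  have hfg' := hfg (⌊n * y⌋ + 1)
  push_cast at hfg'
  rw [hf _ y hy, hg _ y hy, hfg, hfg']

theorem hasDerivAt (hf : IsLinearSpline n f) {k : ℤ} {y : ℝ}
    (hy : y ∈ Set.Ioo (k / n) ((k + 1) / n)) :
    HasDerivAt f (n * (f ((k + 1) / n) - f (k / n))) y := by
  have affine : HasDerivAt
      (fun y => f (k / n) * (k + 1 - n * y) + f ((k + 1) / n) * (n * y - k))
      (n * (f ((k + 1) / n) - f (k / n))) y := by
    have hny : HasDerivAt (fun y => n * y) n y := by simpa using (hasDerivAt_id y).const_mul n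
    refine ((hny.const_sub ((k : ℝ) + 1)).const_mul (f (k / n)) |>.add
      ((hny.sub_const (k : ℝ)).const_mul (f ((k + 1) / n)))).congr_deriv (by ring)
  refine affine.congr_of_eventuallyEq ?_
  filter_upwards [isOpen_Ioo.mem_nhds hy] with x hx using hf k x ⟨hx.1.le, hx.2.le⟩

variable {ι : Type*} [Fintype ι] {c : ι → ℤ}

theorem eq_sum_hat (hn : 0 < n) (hf : IsLinearSpline n f) (hc : Function.Injective c)
    (hf₀ : ∀ z ∉ Set.range c, f (z / n) = 0) :
    f = fun y => ∑ j, f (c j / n) * hat (n * y - c j) := by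
  refine hf.eq_of_eq_on_knots hn
    (sum_const_mul _ fun j => isLinearSpline_one_hat.comp_mul_sub_intCast hn (c j)) fun k => ?_
  simp only [mul_div_cancel₀ _ hn.ne', ← Int.cast_sub, hat_intCast, mul_ite, mul_one, mul_zero]
  by_cases hk : k ∈ Set.range c
  · obtain ⟨i, rfl⟩ := hk
    rw [Finset.sum_eq_single i (fun j _ hj => if_neg (sub_ne_zero.2 (hc.ne hj.symm))) (by simp)]
    simp
  · rw [hf₀ k hk, Finset.sum_eq_zero fun j _ =>
      if_neg (sub_ne_zero.2 fun h => hk ⟨j, h.symm⟩)]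

end IsLinearSpline

theorem isLinearSpline_hat {n : ℝ} (hn : 0 < n) (c : ℤ) :
    IsLinearSpline n fun y => hat (n * y - c) :=
  isLinearSpline_one_hat.comp_mul_sub_intCast hn c

theorem isLinearSpline_two_pow_hat {l L : ℕ} (hl : l ≤ L) (c o : ℤ) :
    IsLinearSpline (2 ^ L) fun y => hat (2 ^ l * (y - o / 2 ^ L) - c) := by
  obtain ⟨r, rfl⟩ := Nat.exists_eq_add_of_le hl
  have := (isLinearSpline_hat (by positivity : (0 : ℝ) < 2 ^ l) c).refine (r := 2 ^ r)
    (by positivity) (by positivity)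
  push_cast at this
  rw [← pow_add] at this
  exact this.comp_sub_knot (by positivity) o

/-! ### The derivative of the hat function -/

theorem lipschitzWith_hat : LipschitzWith 1 hat := by
  refine LipschitzWith.const_max (LipschitzWith.of_dist_le_mul fun x y => ?_) 0
  rw [Real.dist_eq, Real.dist_eq, sub_sub_sub_cancel_left, NNReal.coe_one, one_mul, abs_sub_comm x]
  exact abs_abs_sub_abs_le y x

theorem abs_deriv_hat_le_one (t : ℝ) : |deriv hat t| ≤ 1 := by
  simpa using norm_deriv_le_of_lipschitz lipschitzWith_hat

/-- The hat function is minimal at each of its zeros, also at its kinks. -/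
theorem deriv_hat_of_one_le_abs {t : ℝ} (h : 1 ≤ |t|) : deriv hat t = 0 :=
  IsLocalMin.deriv_eq_zero <| Filter.Eventually.of_forall fun x => by
    rw [hat_of_one_le_abs h]
    exact hat_nonneg x

theorem abs_deriv_hat_le_indicator (t : ℝ) :
    |deriv hat t| ≤ (Set.Ioo (-1 : ℝ) 1).indicator 1 t := by
  by_cases h : t ∈ Set.Ioo (-1 : ℝ) 1
  · rw [Set.indicator_of_mem h]
    exact abs_deriv_hat_le_one t
  · rw [Set.indicator_of_notMem h, deriv_hat_of_one_le_abs (not_lt.1 fun h' => h (abs_lt.1 h')),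
      abs_zero]

theorem hat_eq_floor (t : ℝ) :
    hat t = hat ⌊t⌋ * (⌊t⌋ + 1 - t) + hat (⌊t⌋ + 1) * (t - ⌊t⌋) := by
  simpa using isLinearSpline_one_hat ⌊t⌋ t
    ⟨by simpa using Int.floor_le t, by simpa using (Int.lt_floor_add_one t).le⟩

theorem abs_deriv_hat_le_floor (t : ℝ) : |deriv hat t| ≤ hat ⌊t⌋ + hat (⌊t⌋ + 1) := by
  by_cases h : t ∈ Set.Ioo (-1 : ℝ) 1
  · refine (abs_deriv_hat_le_one t).trans ?_
    have hfloor : -1 ≤ ⌊t⌋ := Int.le_floor.2 (by exact_mod_cast h.1.le)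
    have hfloor' : ⌊t⌋ < 1 := Int.floor_lt.2 (by exact_mod_cast h.2)
    obtain h' | h' : ⌊t⌋ = -1 ∨ ⌊t⌋ = 0 := by omega
    all_goals rw [h']; norm_num [hat]
  · rw [deriv_hat_of_one_le_abs (not_lt.1 fun h' => h (abs_lt.1 h')), abs_zero]
    exact add_nonneg (hat_nonneg _) (hat_nonneg _)

section

variable {ι : Type*} [Fintype ι] {c : ι → ℤ}

theorem sum_hat_sub_le_one (hc : Function.Injective c) (y : ℝ) : ∑ j, hat (y - c j) ≤ 1 := by
  have hk := sum_hat_intCast_sub_le_one hc ⌊y⌋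
  have hk' := sum_hat_intCast_sub_le_one hc (⌊y⌋ + 1)
  push_cast at hk'
  have h₀ := Int.floor_le y
  have h₁ := Int.lt_floor_add_one y
  calc ∑ j, hat (y - c j)
      = ∑ j, (hat (⌊y⌋ - c j) * (⌊y⌋ + 1 - y) + hat (⌊y⌋ + 1 - c j) * (y - ⌊y⌋)) :=
        Finset.sum_congr rfl fun j _ => by
          rw [hat_eq_floor, Int.floor_sub_intCast]
          push_cast
          rw [sub_add_eq_add_sub]
          ring
    _ = (∑ j, hat (⌊y⌋ - c j)) * (⌊y⌋ + 1 - y) +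
          (∑ j, hat (⌊y⌋ + 1 - c j)) * (y - ⌊y⌋) := by
        rw [Finset.sum_add_distrib, Finset.sum_mul, Finset.sum_mul]
    _ ≤ 1 := by nlinarith

theorem sum_abs_deriv_hat_sub_le_two (hc : Function.Injective c) (y : ℝ) :
    ∑ j, |deriv hat (y - c j)| ≤ 2 := by
  have hk := sum_hat_intCast_sub_le_one hc ⌊y⌋
  have hk' := sum_hat_intCast_sub_le_one hc (⌊y⌋ + 1)
  push_cast at hk'
  calc ∑ j, |deriv hat (y - c j)|
      ≤ ∑ j, (hat (⌊y⌋ - c j) + hat (⌊y⌋ + 1 - c j)) := Finset.sum_le_sum fun j _ => by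
        refine (abs_deriv_hat_le_floor _).trans_eq ?_
        rw [Int.floor_sub_intCast]
        push_cast
        rw [sub_add_eq_add_sub]
    _ ≤ 2 := by
        rw [Finset.sum_add_distrib]
        linarith

end

theorem integrable_hat : Integrable hat :=
  continuous_hat.integrable_of_hasCompactSupport <|
    HasCompactSupport.intro (isCompact_Icc (a := (-1 : ℝ)) (b := 1)) fun _ hx =>
      hat_of_one_le_abs (not_le.1 fun h => hx (abs_le.1 h)).le

theorem integral_hat : ∫ t, hat t = 1 :=
  calc ∫ t, hat t = 2 * ∫ t in Set.Ioi (0 : ℝ), max 0 (1 - t) :=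
        integral_comp_abs (f := fun t => max 0 (1 - t))
    _ = 2 * ∫ t in Set.Ioc (0 : ℝ) 1, max 0 (1 - t) := by
        rw [setIntegral_eq_of_subset_of_forall_sdiff_eq_zero measurableSet_Ioi
          Set.Ioc_subset_Ioi_self]
        rintro t ⟨h₀, h₁⟩
        exact max_eq_left (by linarith [not_le.1 fun h => h₁ ⟨h₀, h⟩])
    _ = 2 * ∫ t in (0 : ℝ)..1, (1 - t) := by
        rw [intervalIntegral.integral_of_le zero_le_one,
          setIntegral_congr_fun measurableSet_Ioc fun t ht => max_eq_right (sub_nonneg.2 ht.2)]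
    _ = 1 := by
        rw [intervalIntegral.integral_sub (by simp) (by simp)]
        norm_num [integral_id]

theorem integrable_indicator_Ioo {a b : ℝ} :
    Integrable ((Set.Ioo a b).indicator (1 : ℝ → ℝ)) :=
  (integrable_indicator_iff measurableSet_Ioo).2 (integrableOn_const (by simp))

theorem integrable_abs_deriv_hat : Integrable fun t => |deriv hat t| :=
  integrable_indicator_Ioo.mono' (measurable_deriv hat).abs.aestronglyMeasurable
    (ae_of_all _ fun t => (norm_abs_eq_norm _).trans_le (abs_deriv_hat_le_indicator t))

theorem integral_abs_deriv_hat_le_two : ∫ t, |deriv hat t| ≤ 2 :=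
  calc ∫ t, |deriv hat t| ≤ ∫ t, (Set.Ioo (-1 : ℝ) 1).indicator (1 : ℝ → ℝ) t :=
        integral_mono integrable_abs_deriv_hat integrable_indicator_Ioo abs_deriv_hat_le_indicator
    _ = 2 := by
        rw [integral_indicator_one measurableSet_Ioo]
        norm_num [Measure.real]

theorem deriv_hat_mul_sub (n b y : ℝ) :
    deriv (fun y => hat (n * y - b)) y = n * deriv hat (n * y - b) := by
  rw [deriv_comp_mul_left n (fun y => hat (y - b)), deriv_comp_sub_const, smul_eq_mul]

/-! ### Partial derivatives of tensor products -/

/-- The factor in direction `t` of the partial derivative in direction `s` of a tensor product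
whose factor in direction `t` is `f`. -/
def partialFactor {ι : Type*} [DecidableEq ι] (s t : ι) (f : ℝ → ℝ) : ℝ → ℝ :=
  if t = s then deriv f else f

theorem partialFactor_self {ι : Type*} [DecidableEq ι] (s : ι) (f : ℝ → ℝ) :
    partialFactor s s f = deriv f := if_pos rfl

theorem partialFactor_of_ne {ι : Type*} [DecidableEq ι] {s t : ι} (h : t ≠ s) (f : ℝ → ℝ) :
    partialFactor s t f = f := if_neg h

theorem grad_prod {d : ℕ} (f : Fin d → ℝ → ℝ) (x : Fin d → ℝ) (s : Fin d) :
    grad (fun x => ∏ t, f t (x t)) x s = ∏ t, partialFactor s t (f t) (x t) := by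
  have along : (fun r : ℝ => ∏ t, f t ((x + r • Pi.single s 1 : Fin d → ℝ) t)) = fun r =>
      f s (x s + r) * ∏ t ∈ Finset.univ.erase s, f t (x t) := by
    funext r
    rw [← Finset.mul_prod_erase _ _ (Finset.mem_univ s)]
    congr 1
    · simp
    · refine Finset.prod_congr rfl fun t ht => ?_
      simp [Pi.single_eq_of_ne (Finset.ne_of_mem_erase ht)]
  rw [grad, lineDeriv, along, deriv_mul_const_field, deriv_comp_const_add, add_zero,
    ← Finset.mul_prod_erase _ _ (Finset.mem_univ s), partialFactor_self]
  congr 1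
  exact Finset.prod_congr rfl fun t ht => by rw [partialFactor_of_ne (Finset.ne_of_mem_erase ht)]

section

variable {ι : Type*} [DecidableEq ι] {n : ℝ} (s t : ι)

theorem IsLinearSpline.partialFactor_eq_sum {κ : Type*} [Fintype κ] {c : κ → ℤ} {f : ℝ → ℝ}
    (hn : 0 < n) (hf : IsLinearSpline n f) (hc : Function.Injective c)
    (hf₀ : ∀ z ∉ Set.range c, f (z / n) = 0) {k : ℤ} {y : ℝ}
    (hy : y ∈ Set.Ioo (k / n) ((k + 1) / n)) :
    partialFactor s t f y =
      ∑ j, f (c j / n) * partialFactor s t (fun y => hat (n * y - c j)) y := by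
  by_cases h : t = s
  · subst h
    simp only [partialFactor_self]
    conv_lhs => rw [hf.eq_sum_hat hn hc hf₀]
    have hdiff : ∀ j, DifferentiableAt ℝ (fun y => hat (n * y - c j)) y := fun j =>
      ((isLinearSpline_hat hn (c j)).hasDerivAt hy).differentiableAt
    rw [deriv_fun_sum fun j _ => (hdiff j).const_mul _]
    exact Finset.sum_congr rfl fun j _ => deriv_const_mul _ (hdiff j)
  · simp only [partialFactor_of_ne h]
    exact congrFun (hf.eq_sum_hat hn hc hf₀) y

theorem partialFactor_hat_eq_zero {b y : ℝ} (h : 1 ≤ |n * y - b|) :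
    partialFactor s t (fun y => hat (n * y - b)) y = 0 := by
  unfold partialFactor
  split_ifs
  · rw [deriv_hat_mul_sub, deriv_hat_of_one_le_abs h, mul_zero]
  · exact hat_of_one_le_abs h

theorem sum_abs_partialFactor_hat_le {κ : Type*} [Fintype κ] {c : κ → ℤ} (hn : 0 < n)
    (hc : Function.Injective c) (b y : ℝ) :
    ∑ j, |partialFactor s t (fun y => hat (n * y - (b + c j))) y| ≤
      if t = s then 2 * n else 1 := by
  unfold partialFactor
  split_ifs
  · simp only [deriv_hat_mul_sub, abs_mul, abs_of_pos hn, ← Finset.mul_sum]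
    simp only [← sub_sub]
    linarith [mul_le_mul_of_nonneg_left (sum_abs_deriv_hat_sub_le_two hc (n * y - b)) hn.le]
  · simpa only [abs_of_nonneg (hat_nonneg _), ← sub_sub] using sum_hat_sub_le_one hc (n * y - b)

theorem integrable_abs_partialFactor_hat (hn : 0 < n) (b : ℝ) :
    Integrable fun y => |partialFactor s t (fun y => hat (n * y - b)) y| := by
  unfold partialFactor
  split_ifs
  · simp only [deriv_hat_mul_sub, abs_mul]
    exact ((integrable_abs_deriv_hat.comp_sub_right b).comp_mul_left' hn.ne').const_mul _
  · exact ((integrable_hat.comp_sub_right b).comp_mul_left' hn.ne').abs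

theorem integral_abs_partialFactor_hat_le (hn : 0 < n) (b : ℝ) :
    ∫ y, |partialFactor s t (fun y => hat (n * y - b)) y| ≤
      n⁻¹ * if t = s then 2 * n else 1 := by
  unfold partialFactor
  split_ifs
  · simp only [deriv_hat_mul_sub, abs_mul, abs_of_pos hn]
    rw [integral_const_mul, Measure.integral_comp_mul_left (fun y => |deriv hat (y - b)|),
      integral_sub_right_eq_self (fun y => |deriv hat y|), smul_eq_mul,
      abs_of_pos (inv_pos.2 hn), mul_inv_cancel_left₀ hn.ne', mul_left_comm,
      inv_mul_cancel₀ hn.ne', mul_one]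
    exact integral_abs_deriv_hat_le_two
  · simp only [abs_of_nonneg (hat_nonneg _)]
    rw [Measure.integral_comp_mul_left (fun y => hat (y - b)),
      integral_sub_right_eq_self hat, integral_hat, smul_eq_mul, abs_of_pos (inv_pos.2 hn)]

end

/-- The partial derivative in direction `s` of the tensor product of hat functions with
half-width `1 / n` and centre `b / n`. -/
def nodalDeriv {d : ℕ} (n : ℝ) (b : Fin d → ℝ) (s : Fin d) (x : Fin d → ℝ) : ℝ :=
  ∏ t, partialFactor s t (fun y => hat (n * y - b t)) (x t)

theorem grad_nodalFun {d : ℕ} (l : ℕ) (c : Fin d → ℕ) (x : Fin d → ℝ) (s : Fin d) :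
    grad (nodalFun l c) x s = nodalDeriv (2 ^ l) (fun t => c t) s x :=
  grad_prod (fun t y => hat (2 ^ l * y - c t)) x s

section

variable {d : ℕ} {n : ℝ} (b : Fin d → ℝ) (s : Fin d)

theorem integrable_abs_nodalDeriv (hn : 0 < n) : Integrable fun x => |nodalDeriv n b s x| := by
  simp only [nodalDeriv, Finset.abs_prod]
  exact Integrable.fintype_prod fun t => integrable_abs_partialFactor_hat s t hn (b t)

theorem integral_abs_nodalDeriv_le (hn : 0 < n) :
    ∫ x, |nodalDeriv n b s x| ≤ 2 * n * (n⁻¹) ^ d := by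
  simp only [nodalDeriv, Finset.abs_prod]
  rw [integral_fintype_prod_volume_eq_prod
    (fun t y => |partialFactor s t (fun y => hat (n * y - b t)) y|)]
  calc ∏ t, ∫ y, |partialFactor s t (fun y => hat (n * y - b t)) y|
      ≤ ∏ t, (n⁻¹ * if t = s then 2 * n else 1) :=
        Finset.prod_le_prod (fun t _ => integral_nonneg fun y => abs_nonneg _)
          fun t _ => integral_abs_partialFactor_hat_le s t hn (b t)
    _ = 2 * n * (n⁻¹) ^ d := by
        rw [Finset.prod_mul_distrib, Finset.prod_const, Finset.card_univ, Fintype.card_fin,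
          Finset.prod_ite_eq' Finset.univ s, if_pos (Finset.mem_univ s), mul_comm]

theorem sum_abs_nodalDeriv_le {κ : Type*} [Fintype κ] {c : κ → ℤ} (hn : 0 < n)
    (hc : Function.Injective c) (x : Fin d → ℝ) :
    ∑ j : Fin d → κ, |nodalDeriv n (fun t => b t + c (j t)) s x| ≤ 2 * n := by
  simp only [nodalDeriv, Finset.abs_prod]
  calc ∑ j : Fin d → κ, ∏ t, |partialFactor s t (fun y => hat (n * y - (b t + c (j t)))) (x t)|
      = ∏ t, ∑ i, |partialFactor s t (fun y => hat (n * y - (b t + c i))) (x t)| := by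
        rw [Finset.prod_univ_sum, Fintype.piFinset_univ]
    _ ≤ ∏ t, (if t = s then 2 * n else 1) :=
        Finset.prod_le_prod (fun t _ => Finset.sum_nonneg fun _ _ => abs_nonneg _)
          fun t _ => sum_abs_partialFactor_hat_le s t hn hc (b t) (x t)
    _ = 2 * n := by simp

end

/-! ### Piecewise `ℚ₁` functions -/

theorem prod_affine_mem_QOne {d : ℕ} (a b : Fin d → ℝ) :
    (fun x : Fin d → ℝ => ∏ t, (a t * x t + b t)) ∈ QOne d := by
  have expand : (fun x : Fin d → ℝ => ∏ t, (a t * x t + b t)) =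
      ∑ S ∈ Finset.univ.powerset, ((∏ t ∈ S, a t) * ∏ t ∈ Finset.univ \ S, b t) •
        fun x : Fin d → ℝ => ∏ t ∈ S, x t := by
    funext x
    rw [Finset.prod_add, Finset.sum_apply]
    refine Finset.sum_congr rfl fun S _ => ?_
    rw [Finset.prod_mul_distrib, Pi.smul_apply, smul_eq_mul]
    ring
  rw [expand]
  exact Submodule.sum_mem _ fun S _ =>
    Submodule.smul_mem _ _ (Submodule.subset_span (Set.mem_range_self S))

theorem continuous_of_mem_QOne {d : ℕ} {q : (Fin d → ℝ) → ℝ} (hq : q ∈ QOne d) :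
    Continuous q := by
  induction hq using Submodule.span_induction with
  | mem _ hx =>
    obtain ⟨S, rfl⟩ := hx
    exact continuous_finsetProd S fun t _ => continuous_apply t
  | zero => exact continuous_const
  | add _ _ _ _ hx hy => exact hx.add hy
  | smul a _ _ hx => exact hx.const_smul a

/-- The functions that agree on the set `S` with an element of `ℚ₁`. -/
def IsQOneOn {d : ℕ} (S : Set (Fin d → ℝ)) (f : (Fin d → ℝ) → ℝ) : Prop :=
  ∃ q ∈ QOne d, Set.EqOn f q S

theorem IsQOneOn.sum_const_mul {d : ℕ} {S : Set (Fin d → ℝ)} {ι : Type*} [Fintype ι]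
    {f : ι → (Fin d → ℝ) → ℝ} (a : ι → ℝ) (hf : ∀ i, IsQOneOn S (f i)) :
    IsQOneOn S fun x => ∑ i, a i * f i x := by
  choose q hq hfq using hf
  refine ⟨∑ i, a i • q i, Submodule.sum_mem _ fun i _ => Submodule.smul_mem _ _ (hq i),
    fun x hx => ?_⟩
  simp only [Finset.sum_apply, Pi.smul_apply, smul_eq_mul, hfq _ hx]

theorem IsLinearSpline.exists_partialFactor_eq {ι : Type*} [DecidableEq ι] {n : ℝ} {f : ℝ → ℝ}
    (hf : IsLinearSpline n f) (s t : ι) (k : ℤ) :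
    ∃ a b, ∀ y ∈ Set.Ioo (k / n) ((k + 1) / n), partialFactor s t f y = a * y + b := by
  by_cases h : t = s
  · subst h
    refine ⟨0, n * (f ((k + 1) / n) - f (k / n)), fun y hy => ?_⟩
    rw [partialFactor_self, (hf.hasDerivAt hy).deriv, zero_mul, zero_add]
  · refine ⟨n * (f ((k + 1) / n) - f (k / n)), f (k / n) * (k + 1) - f ((k + 1) / n) * k,
      fun y hy => ?_⟩
    rw [partialFactor_of_ne h, hf k y (Set.Ioo_subset_Icc_self hy)]
    ring

namespace DDGeometry

variable {d : ℕ} (G : DDGeometry d)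

theorem apply_mem_Ioo_of_mem_cellSet {K : G.Cell} {x : Fin d → ℝ} (hx : x ∈ G.cellSet K)
    (t : Fin d) :
    x t ∈ Set.Ioo (((K t : ℕ) : ℤ) / 2 ^ G.L : ℝ) ((((K t : ℕ) : ℤ) + 1) / 2 ^ G.L : ℝ) :=
  hx t (Set.mem_univ t)

theorem isQOneOn_cellSet_prod_partialFactor (K : G.Cell) {f : Fin d → ℝ → ℝ}
    (hf : ∀ t, IsLinearSpline (2 ^ G.L) (f t)) (s : Fin d) :
    IsQOneOn (G.cellSet K) fun x => ∏ t, partialFactor s t (f t) (x t) := by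
  choose a b hab using fun t => (hf t).exists_partialFactor_eq s t (K t : ℕ)
  exact ⟨_, prod_affine_mem_QOne a b, fun x hx =>
    Finset.prod_congr rfl fun t _ => hab t (x t) (G.apply_mem_Ioo_of_mem_cellSet hx t)⟩

theorem grad_φ (v : G.Vertex) (x : Fin d → ℝ) (s : Fin d) :
    grad (G.φ v) x s = nodalDeriv (2 ^ G.L) (fun t => v t + 1) s x := by
  rw [φ, grad_nodalFun]
  push_cast
  rfl

theorem isQOneOn_cellSet_grad_φ (K : G.Cell) (v : G.Vertex) (s : Fin d) :
    IsQOneOn (G.cellSet K) fun x => grad (G.φ v) x s := by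
  simp only [grad_φ]
  exact G.isQOneOn_cellSet_prod_partialFactor K
    (fun t => by exact_mod_cast isLinearSpline_hat (by positivity) ((v t : ℕ) + 1)) s

/-! ### Integration over the mesh elements -/

theorem measurableSet_cellSet (K : G.Cell) : MeasurableSet (G.cellSet K) :=
  MeasurableSet.univ_pi fun _ => measurableSet_Ioo

theorem pairwise_disjoint_cellSet : Pairwise (Function.onFun Disjoint G.cellSet) := by
  refine fun K K' hne => Set.disjoint_left.2 fun x hx hx' => hne ?_
  have hp : (0 : ℝ) < 2 ^ G.L := by positivity
  funext t
  have h := (hx t (Set.mem_univ t)).1.trans (hx' t (Set.mem_univ t)).2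
  have h' := (hx' t (Set.mem_univ t)).1.trans (hx t (Set.mem_univ t)).2
  rw [div_lt_div_iff_of_pos_right hp] at h h'
  have : (K t : ℕ) < K' t + 1 := by exact_mod_cast h
  have : (K' t : ℕ) < K t + 1 := by exact_mod_cast h'
  exact Fin.ext (by omega)

theorem Ω_eq_pi_cells : G.Ω = Set.pi Set.univ fun s => Set.Icc 0 ((G.cells s : ℝ) / 2 ^ G.L) := by
  simp only [Ω, G.cells_div]

theorem cellSet_subset_Ω (K : G.Cell) : G.cellSet K ⊆ G.Ω := by
  rw [Ω_eq_pi_cells]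
  intro x hx t _
  obtain ⟨h₀, h₁⟩ := hx t (Set.mem_univ t)
  have hK : (K t : ℝ) + 1 ≤ G.cells t := by exact_mod_cast (K t).2
  exact ⟨le_trans (by positivity) h₀.le, h₁.le.trans (by gcongr)⟩

theorem integrableOn_cellSet {f : (Fin d → ℝ) → ℝ} (hf : Continuous f) (K : G.Cell) :
    IntegrableOn f (G.cellSet K) :=
  (hf.continuousOn.integrableOn_compact (isCompact_univ_pi fun _ => isCompact_Icc)).mono_set
    (G.cellSet_subset_Ω K)

theorem mem_iUnion_cellSet {x : Fin d → ℝ} (hx : x ∈ G.Ω)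
    (hne : ∀ (s : Fin d) (z : ℕ), x s ≠ z / 2 ^ G.L) : x ∈ ⋃ K, G.cellSet K := by
  rw [Ω_eq_pi_cells] at hx
  have hp : (0 : ℝ) < 2 ^ G.L := by positivity
  have hlt : ∀ s, ⌊2 ^ G.L * x s⌋₊ < G.cells s := fun s => by
    obtain ⟨h₀, h₁⟩ := hx s (Set.mem_univ s)
    rw [Nat.floor_lt (by positivity), ← lt_div_iff₀' hp]
    exact h₁.lt_of_ne (hne s _)
  refine Set.mem_iUnion.2 ⟨fun s => ⟨⌊2 ^ G.L * x s⌋₊, hlt s⟩, fun s _ => ⟨?_, ?_⟩⟩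
  · refine ((div_le_iff₀' hp).2 (Nat.floor_le ?_)).lt_of_ne (hne s _).symm
    exact mul_nonneg hp.le (hx s (Set.mem_univ s)).1
  · exact (lt_div_iff₀' hp).2 (Nat.lt_floor_add_one _)

theorem iUnion_cellSet_ae_eq : (⋃ K, G.cellSet K) =ᵐ[volume] G.Ω := by
  refine Filter.EventuallyLE.antisymm
    (ae_of_all _ (Set.iUnion_subset G.cellSet_subset_Ω)) ?_
  have hne : ∀ᵐ x : Fin d → ℝ, ∀ (s : Fin d) (z : ℕ), x s ≠ z / 2 ^ G.L :=
    ae_all_iff.2 fun s => ae_all_iff.2 fun z =>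
      compl_mem_ae_iff.2 (Measure.pi_hyperplane (fun _ => volume) s _)
  filter_upwards [hne] with x hx hxΩ using G.mem_iUnion_cellSet hxΩ hx

theorem ae_restrict_Ω {p : (Fin d → ℝ) → Prop} (hp : ∀ K, ∀ x ∈ G.cellSet K, p x) :
    ∀ᵐ x ∂volume.restrict G.Ω, p x := by
  rw [← Measure.restrict_congr_set G.iUnion_cellSet_ae_eq]
  refine (ae_restrict_iff' (MeasurableSet.iUnion G.measurableSet_cellSet)).2
    (ae_of_all _ fun x hx => ?_)
  obtain ⟨K, hK⟩ := Set.mem_iUnion.1 hx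
  exact hp K x hK

theorem setIntegral_Ω {f : (Fin d → ℝ) → ℝ} (hf : ∀ K, IntegrableOn f (G.cellSet K)) :
    ∫ x in G.Ω, f x = ∑ K, ∫ x in G.cellSet K, f x := by
  rw [← setIntegral_congr_set G.iUnion_cellSet_ae_eq]
  exact integral_iUnion_fintype G.measurableSet_cellSet G.pairwise_disjoint_cellSet hf

variable {G}

theorem integrableOn_mul_of_isQOneOn {K : G.Cell} {f g : (Fin d → ℝ) → ℝ}
    (hf : IsQOneOn (G.cellSet K) f) (hg : IsQOneOn (G.cellSet K) g) :
    IntegrableOn (fun x => f x * g x) (G.cellSet K) := by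
  obtain ⟨p, hp, hfp⟩ := hf
  obtain ⟨q, hq, hgq⟩ := hg
  refine (G.integrableOn_cellSet ((continuous_of_mem_QOne hp).mul (continuous_of_mem_QOne hq))
    K).congr_fun (fun x hx => ?_) (G.measurableSet_cellSet K)
  rw [Pi.mul_apply, hfp hx, hgq hx]

/-! ### The elementwise gradient -/

variable {ψ : G.Cell → Fin (2 ^ d) → (Fin d → ℝ) → ℝ}

namespace IsDGBasis

variable (h : G.IsDGBasis ψ) {K : G.Cell} {f g : (Fin d → ℝ) → ℝ}

include h

theorem isQOneOn (K : G.Cell) (k : Fin (2 ^ d)) : IsQOneOn (G.cellSet K) (ψ K k) :=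
  ⟨ψ K k, h.span_eq K ▸ Submodule.subset_span (Set.mem_range_self k), Set.eqOn_refl _ _⟩

theorem eqOn_sum_coeff_mul (hf : IsQOneOn (G.cellSet K) f) :
    Set.EqOn f (fun x => ∑ k, (∫ y in G.cellSet K, f y * ψ K k y) * ψ K k x)
      (G.cellSet K) := by
  obtain ⟨p, hp, hfp⟩ := hf
  rw [← h.span_eq K, Submodule.mem_span_range_iff_exists_fun] at hp
  obtain ⟨a, rfl⟩ := hp
  simp only [Set.EqOn, Finset.sum_apply, Pi.smul_apply, smul_eq_mul] at hfp
  have coeff : ∀ k, ∫ y in G.cellSet K, f y * ψ K k y = a k := fun k =>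
    calc ∫ y in G.cellSet K, f y * ψ K k y
        = ∫ y in G.cellSet K, ∑ i, a i * (ψ K i y * ψ K k y) :=
          setIntegral_congr_fun (G.measurableSet_cellSet K) fun y hy => by
            simp only [hfp hy, Finset.sum_mul, mul_assoc]
      _ = a k := by
          rw [integral_finsetSum _ fun i _ =>
            (integrableOn_mul_of_isQOneOn (h.isQOneOn K i) (h.isQOneOn K k)).const_mul (a i)]
          simp [integral_const_mul, h.orthonormal]
  intro x hx
  simp only [coeff, hfp hx]

theorem sum_coeff_mul_coeff (hf : IsQOneOn (G.cellSet K) f) (hg : IsQOneOn (G.cellSet K) g) :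
    ∑ k, (∫ y in G.cellSet K, f y * ψ K k y) * (∫ y in G.cellSet K, g y * ψ K k y) =
      ∫ y in G.cellSet K, f y * g y := by
  simp only [← integral_const_mul]
  rw [← integral_finsetSum _ fun k _ =>
    (integrableOn_mul_of_isQOneOn hg (h.isQOneOn K k)).const_mul _]
  refine setIntegral_congr_fun (G.measurableSet_cellSet K) fun y hy => ?_
  conv_rhs => rw [h.eqOn_sum_coeff_mul hf hy, Finset.sum_mul]
  exact Finset.sum_congr rfl fun k _ => by ring

end IsDGBasis

variable (G) in
/-- The gradient at `y` of the finite element function with the nodal values `x`. -/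
def feGrad (x : G.Vertex → ℝ) (y : Fin d → ℝ) (s : Fin d) : ℝ :=
  ∑ v, x v * grad (G.φ v) y s

theorem isQOneOn_feGrad (x : G.Vertex → ℝ) (K : G.Cell) (s : Fin d) :
    IsQOneOn (G.cellSet K) fun y => G.feGrad x y s :=
  IsQOneOn.sum_const_mul x fun v => G.isQOneOn_cellSet_grad_φ K v s

theorem integrableOn_feGrad_mul_feGrad (x x' : G.Vertex → ℝ) (K : G.Cell) (s t : Fin d) :
    IntegrableOn (fun y => G.feGrad x y s * G.feGrad x' y t) (G.cellSet K) :=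
  integrableOn_mul_of_isQOneOn (isQOneOn_feGrad x K s) (isQOneOn_feGrad x' K t)

theorem gradMatrix_mulVec (h : G.IsDGBasis ψ) (x : G.Vertex → ℝ) (s : Fin d) (K : G.Cell)
    (k : Fin (2 ^ d)) : (G.gradMatrix ψ *ᵥ x) ((s, K), k) =
      ∫ y in G.cellSet K, G.feGrad x y s * ψ K k y := by
  simp only [feGrad, Finset.sum_mul, mul_assoc]
  rw [integral_finsetSum _ fun v _ => (integrableOn_mul_of_isQOneOn
    (G.isQOneOn_cellSet_grad_φ K v s) (h.isQOneOn K k)).const_mul _]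
  simp only [integral_const_mul, Matrix.mulVec, dotProduct, gradMatrix, Matrix.of_apply]
  exact Finset.sum_congr rfl fun v _ => mul_comm _ _

theorem sum_gradMatrix_mulVec_mul (h : G.IsDGBasis ψ) (x x' : G.Vertex → ℝ) (s t : Fin d)
    (K : G.Cell) : ∑ k, (G.gradMatrix ψ *ᵥ x) ((s, K), k) * (G.gradMatrix ψ *ᵥ x') ((t, K), k) =
      ∫ y in G.cellSet K, G.feGrad x y s * G.feGrad x' y t := by
  simp only [gradMatrix_mulVec h]
  exact h.sum_coeff_mul_coeff (isQOneOn_feGrad x K s) (isQOneOn_feGrad x' K t)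

theorem sum_sq_gradMatrix_mulVec (h : G.IsDGBasis ψ) (x : G.Vertex → ℝ) :
    ∑ r, (G.gradMatrix ψ *ᵥ x) r ^ 2 = ∑ s, ∫ y in G.Ω, G.feGrad x y s ^ 2 := by
  simp only [Fintype.sum_prod_type, sq, sum_gradMatrix_mulVec_mul h]
  exact Finset.sum_congr rfl fun s _ =>
    (setIntegral_Ω G fun K => integrableOn_feGrad_mul_feGrad x x K s s).symm

/-! ### The stiffness matrix -/

theorem feGrad_single (v : G.Vertex) (y : Fin d → ℝ) :
    G.feGrad (Pi.single v 1) y = grad (G.φ v) y := by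
  funext s
  simp [feGrad, Pi.single_apply]

theorem integral_cellSet_mulVec_grad (h : G.IsDGBasis ψ) (B : Matrix (Fin d) (Fin d) ℝ)
    (K : G.Cell) (v w : G.Vertex) :
    ∫ x in G.cellSet K, (B *ᵥ grad (G.φ v) x) ⬝ᵥ grad (G.φ w) x =
      ∑ t, ∑ s, B t s * ∑ k, G.gradMatrix ψ ((s, K), k) v * G.gradMatrix ψ ((t, K), k) w := by
  have hint : ∀ s t, IntegrableOn (fun x => B t s * (grad (G.φ v) x s * grad (G.φ w) x t))
      (G.cellSet K) := fun s t => (integrableOn_mul_of_isQOneOn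
    (G.isQOneOn_cellSet_grad_φ K v s) (G.isQOneOn_cellSet_grad_φ K w t)).const_mul _
  simp only [dotProduct, Matrix.mulVec, Finset.sum_mul, mul_assoc]
  rw [integral_finsetSum _ fun t _ => integrable_finsetSum _ fun s _ => hint s t]
  refine Finset.sum_congr rfl fun t _ => ?_
  rw [integral_finsetSum _ fun s _ => hint s t]
  refine Finset.sum_congr rfl fun s _ => ?_
  have gram := sum_gradMatrix_mulVec_mul h (Pi.single v 1) (Pi.single w 1) s t K
  simp only [feGrad_single, Matrix.mulVec_single_one, Matrix.col_apply] at gram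
  rw [integral_const_mul, gram]

theorem integrableOn_mulVec_grad (B : Matrix (Fin d) (Fin d) ℝ) (K : G.Cell) (v w : G.Vertex) :
    IntegrableOn (fun x => (B *ᵥ grad (G.φ v) x) ⬝ᵥ grad (G.φ w) x) (G.cellSet K) := by
  simp only [dotProduct, Matrix.mulVec, Finset.sum_mul, mul_assoc]
  exact integrable_finsetSum _ fun t _ => integrable_finsetSum _ fun s _ =>
    (integrableOn_mul_of_isQOneOn (G.isQOneOn_cellSet_grad_φ K v s)
      (G.isQOneOn_cellSet_grad_φ K w t)).const_mul _

theorem stiffness_eq_transpose_mul_mul (h : G.IsDGBasis ψ)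
    {ρ : (Fin d → ℝ) → Matrix (Fin d) (Fin d) ℝ} {ρK : G.Cell → Matrix (Fin d) (Fin d) ℝ}
    (hρ : ∀ K, ∀ x ∈ G.cellSet K, ρ x = ρK K) :
    G.stiffness ρ = (G.gradMatrix ψ)ᵀ *
      ((G.coeffMatrix ρK)ᵀ ⊗ₖ (1 : Matrix (Fin (2 ^ d)) (Fin (2 ^ d)) ℝ)) * G.gradMatrix ψ := by
  ext v w
  have hcell : ∀ K, Set.EqOn (fun x => (ρK K *ᵥ grad (G.φ v) x) ⬝ᵥ grad (G.φ w) x)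
      (fun x => (ρ x *ᵥ grad (G.φ v) x) ⬝ᵥ grad (G.φ w) x) (G.cellSet K) :=
    fun K x hx => by simp only [hρ K x hx]
  calc G.stiffness ρ v w
      = ∑ K, ∫ x in G.cellSet K, (ρK K *ᵥ grad (G.φ v) x) ⬝ᵥ grad (G.φ w) x := by
        rw [stiffness, Matrix.of_apply, G.setIntegral_Ω fun K =>
          (integrableOn_mulVec_grad (ρK K) K v w).congr_fun (hcell K) (G.measurableSet_cellSet K)]
        exact Finset.sum_congr rfl fun K _ =>
          (setIntegral_congr_fun (G.measurableSet_cellSet K) (hcell K)).symm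
    _ = ∑ K, ∑ t, ∑ s, ρK K t s *
          ∑ k, G.gradMatrix ψ ((s, K), k) v * G.gradMatrix ψ ((t, K), k) w := by
        simp only [integral_cellSet_mulVec_grad h]
    _ = _ := by
        simp only [Matrix.mul_apply, Matrix.transpose_apply, Matrix.kroneckerMap_apply, coeffMatrix,
          Matrix.blockDiagonal_apply, Matrix.one_apply, Fintype.sum_prod_type, Finset.sum_mul,
          mul_ite, mul_one, mul_zero, Finset.sum_ite_eq', Finset.sum_ite_eq,
          Finset.mem_univ, if_true, Finset.mul_sum]
        rw [Finset.sum_comm]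
        refine Finset.sum_congr rfl fun t _ => Finset.sum_congr rfl fun K _ => ?_
        rw [Finset.sum_comm]
        exact Finset.sum_congr rfl fun k _ => Finset.sum_congr rfl fun s _ => by ring

/-! ### Injectivity of the elementwise gradient -/

/-- The mesh element whose upper corner is the vertex `v`. -/
def lowerCell (v : G.Vertex) : G.Cell := fun s => ⟨v s, (v s).2.trans_le (Nat.sub_le _ _)⟩

theorem mem_cellSet_lowerCell {v : G.Vertex} {y : Fin d → ℝ} (hy : y ∈ G.cellSet (lowerCell v))
    (t : Fin d) : (v t : ℝ) < 2 ^ G.L * y t ∧ 2 ^ G.L * y t < v t + 1 := by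
  have hp : (0 : ℝ) < 2 ^ G.L := by positivity
  obtain ⟨h₀, h₁⟩ := hy t (Set.mem_univ t)
  exact ⟨(div_lt_iff₀' hp).1 h₀, (lt_div_iff₀' hp).1 h₁⟩

theorem nonempty_cellSet (K : G.Cell) : (G.cellSet K).Nonempty :=
  Set.univ_pi_nonempty_iff.2 fun t => Set.nonempty_Ioo.2 (by gcongr; linarith)

/-- On the mesh element below a minimal vertex of the support, all the other nodal functions of
the support vanish. -/
theorem feGrad_eq_mul_grad_of_minimal {x : G.Vertex → ℝ} {v : G.Vertex}
    (hv : Minimal (fun v => x v ≠ 0) v) {y : Fin d → ℝ} (hy : y ∈ G.cellSet (lowerCell v))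
    (s : Fin d) : G.feGrad x y s = x v * grad (G.φ v) y s := by
  refine Finset.sum_eq_single v (fun w _ hw => ?_) (by simp)
  by_cases hxw : x w = 0
  · rw [hxw, zero_mul]
  obtain ⟨t, ht⟩ : ∃ t, v t < w t := by
    by_contra! hle
    exact hw (le_antisymm hle (hv.2 hxw hle))
  have ht' : (v t : ℝ) + 1 ≤ w t := by exact_mod_cast ht
  rw [grad_φ, nodalDeriv, Finset.prod_eq_zero (Finset.mem_univ t), mul_zero]
  exact partialFactor_hat_eq_zero s t
    (le_abs.2 (.inr (by linarith [(mem_cellSet_lowerCell hy t).2])))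

theorem grad_φ_pos {v : G.Vertex} {y : Fin d → ℝ} (hy : y ∈ G.cellSet (lowerCell v)) (s : Fin d) :
    0 < grad (G.φ v) y s := by
  rw [grad_φ]
  refine Finset.prod_pos fun t _ => ?_
  obtain ⟨h₀, h₁⟩ := mem_cellSet_lowerCell hy t
  by_cases hts : t = s
  · subst hts
    have hderiv := ((isLinearSpline_hat (by positivity : (0 : ℝ) < 2 ^ G.L)
      ((v t : ℕ) + 1)).hasDerivAt (G.apply_mem_Ioo_of_mem_cellSet hy t)).deriv
    simp only [lowerCell, Int.cast_add, Int.cast_natCast, Int.cast_one,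
      mul_div_cancel₀ _ (by positivity : (2 : ℝ) ^ G.L ≠ 0)] at hderiv
    rw [partialFactor_self, hderiv]
    norm_num [hat]
  · rw [partialFactor_of_ne hts]
    exact hat_pos_iff.2 (abs_lt.2 ⟨by linarith, by linarith⟩)

theorem gradMatrix_mulVec_injective (h : G.IsDGBasis ψ) (s : Fin d) :
    Function.Injective (G.gradMatrix ψ).mulVec := by
  refine (injective_iff_map_eq_zero (G.gradMatrix ψ).mulVecLin).2 fun x hx => ?_
  by_contra hx₀
  obtain ⟨v, hv⟩ : ∃ v, Minimal (fun v => x v ≠ 0) v :=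
    exists_minimal_of_wellFoundedLT _ (Function.ne_iff.1 hx₀)
  obtain ⟨y, hy⟩ := nonempty_cellSet (lowerCell v)
  have hgrad : G.feGrad x y s = 0 := by
    refine (h.eqOn_sum_coeff_mul (isQOneOn_feGrad x (lowerCell v) s) hy).trans
      (Finset.sum_eq_zero fun k _ => ?_)
    rw [← gradMatrix_mulVec h]
    exact mul_eq_zero_of_left (congrFun hx ((s, lowerCell v), k)) _
  rw [feGrad_eq_mul_grad_of_minimal hv hy] at hgrad
  exact mul_ne_zero hv.1 (grad_φ_pos hy s).ne' hgrad

end DDGeometry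

/-! ### Gradients of the columns of the BPX factor -/

namespace DDGeometry

variable {d : ℕ} (G : DDGeometry d)

/-- The index, in direction `t`, of the lower corner of the subdomain `i` on the finest grid. -/
def offset (i : G.Sub) (t : Fin d) : ℕ := i t * (2 ^ G.L - G.m)

variable {G}

theorem feGrad_mulVec {n : Type*} [Fintype n] (M : Matrix G.Vertex n ℝ) (z : n → ℝ)
    (y : Fin d → ℝ) (s : Fin d) :
    G.feGrad (M *ᵥ z) y s = ∑ c, z c * G.feGrad (M.col c) y s := by
  simp only [feGrad, Matrix.mulVec, dotProduct, Finset.sum_mul, Finset.mul_sum, Matrix.col_apply]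
  rw [Finset.sum_comm]
  exact Finset.sum_congr rfl fun c _ => Finset.sum_congr rfl fun v _ => by ring

theorem feGrad_restriction_transpose_mulVec (i : G.Sub) (u : CubeVertex d G.L → ℝ)
    (y : Fin d → ℝ) (s : Fin d) :
    G.feGrad ((G.restriction i)ᵀ *ᵥ u) y s = ∑ w, u w * grad (G.φ (G.embed i w)) y s := by
  rw [feGrad_mulVec]
  refine Finset.sum_congr rfl fun w _ => ?_
  rw [← feGrad_single]
  congr 2
  ext v
  simp [restriction, Matrix.one_apply, Pi.single_apply]

theorem feGrad_restriction_transpose_mulVec_prod (i : G.Sub) {f : Fin d → ℝ → ℝ}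
    (hf : ∀ t, IsLinearSpline (2 ^ G.L) (f t))
    (hf₀ : ∀ t, ∀ z ∉ Set.range fun w : Fin (2 ^ G.L - 1) => (G.offset i t : ℤ) + w + 1,
      f t (z / 2 ^ G.L) = 0) {K : G.Cell} {y : Fin d → ℝ} (hy : y ∈ G.cellSet K) (s : Fin d) :
    G.feGrad ((G.restriction i)ᵀ *ᵥ
      fun w => ∏ t, f t (((G.offset i t : ℝ) + w t + 1) / 2 ^ G.L)) y s =
        ∏ t, partialFactor s t (f t) (y t) := by
  have hinj : ∀ t, Function.Injective
      fun w : Fin (2 ^ G.L - 1) => (G.offset i t : ℤ) + w + 1 := fun t w w' hw => by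
    simpa [Fin.ext_iff] using hw
  have expand := fun t => (hf t).partialFactor_eq_sum s t (by positivity) (hinj t) (hf₀ t)
    (G.apply_mem_Ioo_of_mem_cellSet hy t)
  simp only [feGrad_restriction_transpose_mulVec, expand, Finset.prod_univ_sum,
    Fintype.piFinset_univ, grad_φ, nodalDeriv, ← Finset.prod_mul_distrib, embed, offset]
  push_cast
  rfl

theorem hat_level_eq_zero_of_notMem_range {L l o : ℕ} {j : Fin (2 ^ l - 1)} {z : ℤ}
    (hz : z ∉ Set.range fun w : Fin (2 ^ L - 1) => (o : ℤ) + w + 1) :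
    hat (2 ^ l * ((z : ℝ) / 2 ^ L - o / 2 ^ L) - (j + 1)) = 0 := by
  have hj : ((j : ℕ) : ℝ) + 1 + 1 ≤ 2 ^ l := by
    have := j.2
    exact_mod_cast (by omega : (j : ℕ) + 1 + 1 ≤ 2 ^ l)
  rw [← sub_div]
  refine hat_of_one_le_abs (le_abs.2 ?_)
  obtain hzo | hzo : z - o ≤ 0 ∨ (2 : ℤ) ^ L ≤ z - o := by
    by_contra! h
    have hL : (((2 ^ L : ℕ)) : ℤ) = 2 ^ L := by push_cast; rfl
    exact hz ⟨⟨(z - o - 1).toNat, by omega⟩, by simp only; omega⟩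
  · have hzo' : ((z : ℝ) - o) / 2 ^ L ≤ 0 :=
      div_nonpos_of_nonpos_of_nonneg (by exact_mod_cast hzo) (by positivity)
    exact .inr (by nlinarith [(by positivity : (0 : ℝ) < 2 ^ l)])
  · have hzo' : 1 ≤ ((z : ℝ) - o) / 2 ^ L :=
      (one_le_div (by positivity)).2 (by exact_mod_cast hzo)
    exact .inl (by nlinarith [(by positivity : (0 : ℝ) < 2 ^ l)])

end DDGeometry

/-- The weight `2 ^ (-l (2 - d) / 2)` of the level `l` of the BPX factor. -/
def bpxWeight (d l : ℕ) : ℝ := (2 : ℝ) ^ (-(l : ℝ) * (2 - (d : ℝ)) / 2)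

theorem bpxWeight_pos (d l : ℕ) : 0 < bpxWeight d l := Real.rpow_pos_of_pos two_pos _

theorem bpxWeight_sq_mul (d l : ℕ) : bpxWeight d l ^ 2 * (2 ^ l) ^ 2 * ((2 ^ l)⁻¹) ^ d = 1 := by
  simp only [bpxWeight, ← Real.rpow_natCast, ← Real.rpow_neg two_pos.le, ← Real.rpow_mul two_pos.le,
    ← Real.rpow_add two_pos]
  push_cast
  ring_nf
  exact Real.rpow_zero 2

theorem bpxFactor_apply {d L : ℕ} (w : CubeVertex d L) (l : Fin L) (j : CubeVertex d (l + 1))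
    (o : Fin d → ℝ) : bpxFactor d L w ⟨l, j⟩ = bpxWeight d (l + 1) *
      ∏ t, hat (2 ^ (l + 1 : ℕ) * ((o t + w t + 1) / 2 ^ L - o t / 2 ^ L) - (j t + 1)) := by
  have shift : ∀ t, (o t + w t + 1) / 2 ^ L - o t / 2 ^ L = ((w t : ℝ) + 1) / 2 ^ L :=
    fun t => by ring
  simp only [bpxFactor, levelEmbedding, nodalFun, bpxWeight, Matrix.of_apply, shift,
    Nat.cast_add, Nat.cast_one]

namespace DDGeometry

variable {d : ℕ} (G : DDGeometry d)

/-- The local part `(R₁ᵀ F₁ | ⋯ | R_Nᵀ F_N)` of the Schwarz factor. -/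
def localFactor : Matrix G.Vertex (G.Sub × BPXIndex d G.L) ℝ :=
  Matrix.of fun v c => ((G.restriction c.1)ᵀ * bpxFactor d G.L) v c.2

/-- The partial derivative in direction `s` of the function whose nodal values are the column `c`
of the local factor. -/
def localDeriv (s : Fin d) (c : G.Sub × BPXIndex d G.L) (y : Fin d → ℝ) : ℝ :=
  bpxWeight d (c.2.1 + 1) * nodalDeriv (2 ^ (c.2.1 + 1 : ℕ))
    (fun t => 2 ^ (c.2.1 + 1 : ℕ) * (G.offset c.1 t / 2 ^ G.L) + (c.2.2 t + 1 : ℕ)) s y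

variable {G}

theorem feGrad_localFactor_col (c : G.Sub × BPXIndex d G.L) {K : G.Cell} {y : Fin d → ℝ}
    (hy : y ∈ G.cellSet K) (s : Fin d) :
    G.feGrad (G.localFactor.col c) y s = G.localDeriv s c y := by
  obtain ⟨i, l, j⟩ := c
  let f : Fin d → ℝ → ℝ := fun t y =>
    hat (2 ^ (l + 1 : ℕ) * (y - G.offset i t / 2 ^ G.L) - (j t + 1))
  have hf : ∀ t, IsLinearSpline (2 ^ G.L) (f t) := fun t => by
    have hl : (l + 1 : ℕ) ≤ G.L := l.2
    simpa using isLinearSpline_two_pow_hat hl ((j t : ℕ) + 1) (G.offset i t)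
  have hcol : G.localFactor.col (i, ⟨l, j⟩) = (G.restriction i)ᵀ *ᵥ
      (bpxWeight d (l + 1) • fun w => ∏ t, f t (((G.offset i t : ℝ) + w t + 1) / 2 ^ G.L)) := by
    change (G.restriction i)ᵀ *ᵥ (fun w => bpxFactor d G.L w ⟨l, j⟩) = _
    congr 1
    funext w
    exact bpxFactor_apply w l j fun t => G.offset i t
  have hsmul : G.feGrad (G.localFactor.col (i, ⟨l, j⟩)) y s = bpxWeight d (l + 1) *
      G.feGrad ((G.restriction i)ᵀ *ᵥ
        fun w => ∏ t, f t (((G.offset i t : ℝ) + w t + 1) / 2 ^ G.L)) y s := by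
    simp only [hcol, Matrix.mulVec_smul, feGrad, Pi.smul_apply, smul_eq_mul, mul_assoc,
      Finset.mul_sum]
  rw [hsmul, feGrad_restriction_transpose_mulVec_prod i hf
    (fun t z hz => hat_level_eq_zero_of_notMem_range hz) hy]
  simp only [localDeriv, nodalDeriv, f, mul_sub, sub_sub, Nat.cast_add, Nat.cast_one]

/-! ### The upper bound -/

theorem sum_abs_localDeriv_div_le (s : Fin d) (y : Fin d → ℝ) :
    ∑ c, |G.localDeriv s c y| / (2 * 2 ^ (c.2.1 + 1 : ℕ) * bpxWeight d (c.2.1 + 1)) ≤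
      G.numSub * G.L := by
  have level : ∀ (i : G.Sub) (l : Fin G.L), ∑ j : CubeVertex d (l + 1),
      |G.localDeriv s (i, ⟨l, j⟩) y| / (2 * 2 ^ (l + 1 : ℕ) * bpxWeight d (l + 1)) ≤ 1 := by
    intro i l
    have hw := bpxWeight_pos d (l + 1)
    simp only [localDeriv, abs_mul, abs_of_pos hw, ← Finset.sum_div, ← Finset.mul_sum]
    rw [div_le_one (by positivity), mul_comm]
    gcongr
    have hinj : Function.Injective fun j : Fin (2 ^ (l + 1 : ℕ) - 1) => ((j + 1 : ℕ) : ℤ) :=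
      fun j j' h => by simpa [Fin.ext_iff] using h
    simpa only [Int.cast_natCast] using sum_abs_nodalDeriv_le (n := 2 ^ (l + 1 : ℕ))
      (fun t => 2 ^ (l + 1 : ℕ) * (G.offset i t / 2 ^ G.L)) s (by positivity) hinj y
  calc _ = ∑ i : G.Sub, ∑ l : Fin G.L, ∑ j : CubeVertex d (l + 1),
        |G.localDeriv s (i, ⟨l, j⟩) y| / (2 * 2 ^ (l + 1 : ℕ) * bpxWeight d (l + 1)) := by
        rw [Fintype.sum_prod_type]
        exact Finset.sum_congr rfl fun i _ => Fintype.sum_sigma _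
    _ ≤ ∑ _i : G.Sub, ∑ _l : Fin G.L, (1 : ℝ) :=
        Finset.sum_le_sum fun i _ => Finset.sum_le_sum fun l _ => level i l
    _ = G.numSub * G.L := by simp [numSub]

theorem integrable_abs_localDeriv (s : Fin d) (c : G.Sub × BPXIndex d G.L) :
    Integrable fun y => |G.localDeriv s c y| := by
  simp only [localDeriv, abs_mul]
  exact (integrable_abs_nodalDeriv _ s (by positivity)).const_mul _

theorem mul_integral_abs_localDeriv_le (s : Fin d) (c : G.Sub × BPXIndex d G.L) :
    2 * 2 ^ (c.2.1 + 1 : ℕ) * bpxWeight d (c.2.1 + 1) * ∫ y, |G.localDeriv s c y| ≤ 4 := by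
  set l := (c.2.1 + 1 : ℕ)
  have hw := bpxWeight_pos d l
  simp only [localDeriv, abs_mul]
  rw [integral_const_mul, abs_of_pos hw]
  calc _ ≤ 2 * 2 ^ l * bpxWeight d l * (bpxWeight d l * (2 * 2 ^ l * ((2 ^ l)⁻¹) ^ d)) := by
        gcongr
        exact integral_abs_nodalDeriv_le _ s (by positivity)
    _ = 4 * (bpxWeight d l ^ 2 * (2 ^ l) ^ 2 * ((2 ^ l)⁻¹) ^ d) := by ring
    _ = 4 := by rw [bpxWeight_sq_mul, mul_one]

end DDGeometry

/-- The Schur test. -/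
theorem integral_sq_sum_mul_le {α ι : Type*} [MeasurableSpace α] {μ : Measure α} [Fintype ι]
    {D : ι → α → ℝ} {w : ι → ℝ} {R S : ℝ} (hw : ∀ c, 0 < w c) (hR₀ : 0 ≤ R)
    (hD : ∀ c, Integrable (fun x => |D c x|) μ) (hR : ∀ x, ∑ c, |D c x| / w c ≤ R)
    (hS : ∀ c, w c * ∫ x, |D c x| ∂μ ≤ S) (z : ι → ℝ) :
    ∫ x, (∑ c, z c * D c x) ^ 2 ∂μ ≤ R * S * ∑ c, z c ^ 2 := by
  have pointwise : ∀ x, (∑ c, z c * D c x) ^ 2 ≤ R * ∑ c, z c ^ 2 * w c * |D c x| := fun x =>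
    calc (∑ c, z c * D c x) ^ 2
        ≤ (∑ c, |D c x| / w c) * ∑ c, z c ^ 2 * w c * |D c x| :=
          Finset.sum_sq_le_sum_mul_sum_of_sq_le_mul _
            (fun c _ => div_nonneg (abs_nonneg _) (hw c).le)
            (fun c _ => mul_nonneg (mul_nonneg (sq_nonneg _) (hw c).le) (abs_nonneg _))
            fun c _ => le_of_eq <| by
              rw [mul_pow, ← sq_abs (D c x)]
              field_simp [(hw c).ne']
      _ ≤ R * ∑ c, z c ^ 2 * w c * |D c x| := mul_le_mul_of_nonneg_right (hR x) <|
          Finset.sum_nonneg fun c _ => mul_nonneg (mul_nonneg (sq_nonneg _) (hw c).le)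
            (abs_nonneg _)
  calc ∫ x, (∑ c, z c * D c x) ^ 2 ∂μ
      ≤ ∫ x, R * ∑ c, z c ^ 2 * w c * |D c x| ∂μ :=
        integral_mono_of_nonneg (ae_of_all _ fun x => sq_nonneg _)
          ((integrable_finsetSum _ fun c _ => (hD c).const_mul _).const_mul _)
          (ae_of_all _ pointwise)
    _ = R * ∑ c, z c ^ 2 * (w c * ∫ x, |D c x| ∂μ) := by
        rw [integral_const_mul, integral_finsetSum _ fun c _ => (hD c).const_mul _]
        simp only [integral_const_mul, mul_assoc]
    _ ≤ R * ∑ c, z c ^ 2 * S := by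
        gcongr with c
        exact hS c
    _ = R * S * ∑ c, z c ^ 2 := by rw [← Finset.sum_mul]; ring

namespace DDGeometry

variable {d : ℕ} {G : DDGeometry d} {ψ : G.Cell → Fin (2 ^ d) → (Fin d → ℝ) → ℝ}

theorem integral_Ω_sq_feGrad_localFactor_mulVec_le (z : G.Sub × BPXIndex d G.L → ℝ) (s : Fin d) :
    ∫ y in G.Ω, G.feGrad (G.localFactor *ᵥ z) y s ^ 2 ≤
      4 * G.numSub * G.L * ∑ c, z c ^ 2 := by
  have hsum : ∀ K, ∀ y ∈ G.cellSet K,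
      G.feGrad (G.localFactor *ᵥ z) y s ^ 2 = (∑ c, z c * G.localDeriv s c y) ^ 2 :=
    fun K y hy => by simp only [feGrad_mulVec, feGrad_localFactor_col _ hy]
  rw [integral_congr_ae (G.ae_restrict_Ω hsum)]
  have hS : ∀ c, 2 * 2 ^ (c.2.1 + 1 : ℕ) * bpxWeight d (c.2.1 + 1) *
      ∫ y in G.Ω, |G.localDeriv s c y| ≤ 4 := fun c => by
    refine le_trans ?_ (mul_integral_abs_localDeriv_le s c)
    have hw := bpxWeight_pos d (c.2.1 + 1)
    exact mul_le_mul_of_nonneg_left (setIntegral_le_integral (integrable_abs_localDeriv s c)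
      (ae_of_all _ fun y => abs_nonneg _)) (by positivity)
  refine (integral_sq_sum_mul_le (fun c => mul_pos (by positivity) (bpxWeight_pos _ _))
    (by positivity) (fun c => (integrable_abs_localDeriv s c).integrableOn)
    (sum_abs_localDeriv_div_le s) hS z).trans_eq (by ring)

theorem sum_sq_gradMatrix_mul_localFactor_mulVec_le (h : G.IsDGBasis ψ)
    (z : G.Sub × BPXIndex d G.L → ℝ) :
    ∑ r, ((G.gradMatrix ψ * G.localFactor) *ᵥ z) r ^ 2 ≤
      4 * G.numSub * d * G.L * ∑ c, z c ^ 2 := by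
  rw [← Matrix.mulVec_mulVec, sum_sq_gradMatrix_mulVec h]
  refine (Finset.sum_le_sum fun s _ => integral_Ω_sq_feGrad_localFactor_mulVec_le z s).trans_eq ?_
  rw [Finset.sum_const, Finset.card_univ, Fintype.card_fin, nsmul_eq_mul]
  ring

end DDGeometry

/-! ### The lower bound -/

namespace IsLinearSpline

variable {n : ℝ} {f : ℝ → ℝ}

theorem mul_sq_half_add_le_integral_sq (hn : 0 < n) (hf : IsLinearSpline n f) (k : ℤ) :
    n⁻¹ * ((f ((k + 1) / n) + f (k / n)) / 2) ^ 2 ≤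
      ∫ y in Set.Ioo (k / n) ((k + 1) / n), f y ^ 2 := by
  set a := f (k / n)
  set b := f ((k + 1) / n)
  let q : ℝ → ℝ := fun u => a ^ 2 + 2 * a * (b - a) * u + (b - a) ^ 2 * u ^ 2
  have rescale : ∀ y ∈ Set.Ioo (k / n) ((k + 1) / n), f y ^ 2 = q (n * y - k) := fun y hy => by
    rw [hf k y ⟨hy.1.le, hy.2.le⟩]
    ring
  have average : ((b + a) / 2) ^ 2 ≤ ∫ u in (0 : ℝ)..1, q u := by
    have : ∫ u in (0 : ℝ)..1, q u = a ^ 2 + 2 * a * (b - a) * (1 / 2) + (b - a) ^ 2 * (1 / 3) := by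
      rw [intervalIntegral.integral_add (Continuous.intervalIntegrable (by fun_prop) _ _)
          (Continuous.intervalIntegrable (by fun_prop) _ _),
        intervalIntegral.integral_add (Continuous.intervalIntegrable (by fun_prop) _ _)
          (Continuous.intervalIntegrable (by fun_prop) _ _),
        intervalIntegral.integral_const_mul, intervalIntegral.integral_const_mul, integral_id,
        integral_pow, intervalIntegral.integral_const]
      norm_num
    nlinarith [sq_nonneg (b - a)]
  rw [setIntegral_congr_fun measurableSet_Ioo rescale, ← integral_Ioc_eq_integral_Ioo,
    ← intervalIntegral.integral_of_le (by gcongr; linarith),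
    intervalIntegral.integral_comp_mul_sub q hn.ne', mul_div_cancel₀ _ hn.ne',
    mul_div_cancel₀ _ hn.ne', sub_self, add_sub_cancel_left, smul_eq_mul]
  gcongr

theorem integral_deriv_sq (hn : 0 < n) (hf : IsLinearSpline n f) (k : ℤ) :
    ∫ y in Set.Ioo (k / n) ((k + 1) / n), deriv f y ^ 2 =
      n * (f ((k + 1) / n) - f (k / n)) ^ 2 := by
  rw [setIntegral_congr_fun measurableSet_Ioo fun y hy => by rw [(hf.hasDerivAt hy).deriv],
    setIntegral_const, measureReal_def, Real.volume_Ioo, ← sub_div, add_sub_cancel_left,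
    ENNReal.toReal_ofReal (by positivity), smul_eq_mul]
  field_simp

end IsLinearSpline

/-- The linear spline on the grid of mesh size `2 ^ (-L)` of the unit interval with the value
`ε ^ k` at each interior vertex `k / 2 ^ L` and zero boundary values. -/
def powSpline (L : ℕ) (ε : ℝ) (y : ℝ) : ℝ :=
  ∑ j : Fin (2 ^ L - 1), ε ^ (j + 1 : ℕ) * hat (2 ^ L * y - ((j + 1 : ℕ) : ℤ))

theorem isLinearSpline_powSpline (L : ℕ) (ε : ℝ) : IsLinearSpline (2 ^ L) (powSpline L ε) :=
  IsLinearSpline.sum_const_mul _ fun _ => isLinearSpline_hat (by positivity) _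

theorem powSpline_intCast_div (L : ℕ) (ε : ℝ) (z : ℤ) : powSpline L ε (z / 2 ^ L) =
    ∑ j : Fin (2 ^ L - 1), if z = ((j + 1 : ℕ) : ℤ) then ε ^ (j + 1 : ℕ) else 0 := by
  simp only [powSpline, mul_div_cancel₀ (z : ℝ) (by positivity : (2 : ℝ) ^ L ≠ 0), ← Int.cast_sub,
    hat_intCast, sub_eq_zero, mul_ite, mul_one, mul_zero]

theorem powSpline_natCast_div (L : ℕ) (ε : ℝ) (k : ℕ) :
    powSpline L ε (k / 2 ^ L) = if 1 ≤ k ∧ k < 2 ^ L then ε ^ k else 0 := by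
  rw [← Int.cast_natCast (R := ℝ), powSpline_intCast_div]
  simp only [Nat.cast_inj]
  rw [Fin.sum_univ_eq_sum_range (fun j => if k = j + 1 then ε ^ (j + 1) else 0)]
  cases k with
  | zero => simp
  | succ k =>
    simp only [add_left_inj, Finset.sum_ite_eq, Finset.mem_range]
    exact if_congr (by omega) rfl rfl

theorem partialFactor_powSpline {ι : Type*} [DecidableEq ι] {L : ℕ} (s t : ι) (ε : ℝ) {k : ℤ}
    {y : ℝ} (hy : y ∈ Set.Ioo (k / 2 ^ L : ℝ) ((k + 1) / 2 ^ L)) :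
    partialFactor s t (powSpline L ε) y = ∑ j : Fin (2 ^ L - 1),
      ε ^ (j + 1 : ℕ) * partialFactor s t (fun y => hat (2 ^ L * y - ((j + 1 : ℕ) : ℤ))) y := by
  have hinj : Function.Injective fun j : Fin (2 ^ L - 1) => ((j + 1 : ℕ) : ℤ) :=
    fun j j' h => by simpa [Fin.ext_iff] using h
  rw [(isLinearSpline_powSpline L ε).partialFactor_eq_sum s t (by positivity) hinj
    (fun z hz => ?_) hy]
  · refine Finset.sum_congr rfl fun j _ => ?_
    rw [Int.cast_natCast, powSpline_natCast_div, if_pos (by omega)]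
  · rw [powSpline_intCast_div]
    exact Finset.sum_eq_zero fun j _ => if_neg fun h => hz ⟨j, h.symm⟩

theorem sum_sq_powSpline_add_mul {L : ℕ} (hL : L ≠ 0) {ε : ℝ} (hε : ε ^ 2 = 1) :
    ∑ k ∈ Finset.range (2 ^ L),
      (powSpline L ε ((k + 1) / 2 ^ L) + ε * powSpline L ε (k / 2 ^ L)) ^ 2 =
        4 * (2 ^ L - 3 / 2) := by
  obtain ⟨m, hm⟩ : ∃ m, 2 ^ L = m + 2 := Nat.exists_eq_add_of_le' (Nat.le_self_pow hL 2)
  have hm' : (2 : ℝ) ^ L = m + 2 := by exact_mod_cast hm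
  have knot := fun k : ℕ => powSpline_natCast_div L ε k
  have next : ∀ k : ℕ, powSpline L ε (((k : ℝ) + 1) / 2 ^ L) =
      if 1 ≤ k + 1 ∧ k + 1 < 2 ^ L then ε ^ (k + 1) else 0 := fun k => by
    exact_mod_cast knot (k + 1)
  have pow_sq : ∀ k, (ε ^ k) ^ 2 = 1 := fun k => by rw [pow_right_comm, hε, one_pow]
  have inner : ∀ k ∈ Finset.range m, (powSpline L ε (((k + 1 : ℕ) + 1) / 2 ^ L) +
      ε * powSpline L ε ((k + 1 : ℕ) / 2 ^ L)) ^ 2 = 4 := fun k hk => by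
    have := Finset.mem_range.1 hk
    rw [next, knot, if_pos (by omega), if_pos (by omega), ← pow_succ', ← two_mul, mul_pow, pow_sq]
    norm_num
  have first : (powSpline L ε (((0 : ℕ) + 1) / 2 ^ L) +
      ε * powSpline L ε ((0 : ℕ) / 2 ^ L)) ^ 2 = 1 := by
    rw [next, knot, if_pos (by omega), if_neg (by omega), mul_zero, add_zero, pow_sq]
  have last : (powSpline L ε (((m + 1 : ℕ) + 1) / 2 ^ L) +
      ε * powSpline L ε ((m + 1 : ℕ) / 2 ^ L)) ^ 2 = 1 := by
    rw [next, knot, if_neg (by omega), if_pos (by omega), zero_add, ← pow_succ', pow_sq]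
  rw [hm, Finset.sum_range_succ, last, Finset.sum_range_succ', first, Finset.sum_congr rfl inner,
    hm', Finset.sum_const, Finset.card_range, nsmul_eq_mul]
  ring

theorem le_sum_integral_sq_partialFactor_powSpline {ι : Type*} [DecidableEq ι] {L N : ℕ}
    (hL : L ≠ 0) (hN : 2 ^ L ≤ N) (s t : ι) :
    (if t = s then 4 * (2 ^ L) ^ 2 else 1) * ((2 ^ L - 3 / 2) * (2 ^ L)⁻¹) ≤
      ∑ k : Fin N, ∫ y in Set.Ioo (((k : ℕ) : ℝ) / 2 ^ L) ((((k : ℕ) : ℝ) + 1) / 2 ^ L),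
        partialFactor s t (powSpline L (if t = s then -1 else 1)) y ^ 2 := by
  have hn : (0 : ℝ) < 2 ^ L := by positivity
  rw [Fin.sum_univ_eq_sum_range (fun k => ∫ y in Set.Ioo ((k : ℝ) / 2 ^ L) ((k + 1) / 2 ^ L),
    partialFactor s t (powSpline L (if t = s then -1 else 1)) y ^ 2)]
  refine le_trans ?_ (Finset.sum_le_sum_of_subset_of_nonneg (Finset.range_subset_range.2 hN)
    fun _ _ _ => integral_nonneg fun _ => sq_nonneg _)
  obtain rfl | h := eq_or_ne t s
  · have energy := fun k : ℕ => (isLinearSpline_powSpline L (-1)).integral_deriv_sq hn k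
    simp only [Int.cast_natCast] at energy
    simp only [if_true, partialFactor_self, energy, ← Finset.mul_sum]
    have := sum_sq_powSpline_add_mul hL (ε := -1) (by norm_num)
    simp only [neg_one_mul, ← sub_eq_add_neg] at this
    rw [this]
    refine le_of_eq ?_
    field_simp
  · have mass := fun k : ℕ => (isLinearSpline_powSpline L 1).mul_sq_half_add_le_integral_sq hn k
    simp only [Int.cast_natCast] at mass
    simp only [if_neg h, partialFactor_of_ne h]
    refine le_trans (le_of_eq ?_) (Finset.sum_le_sum fun k _ => mass k)
    have := sum_sq_powSpline_add_mul hL (ε := 1) (by norm_num)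
    simp only [one_mul] at this
    simp only [div_pow, ← Finset.mul_sum, ← Finset.sum_div, this]
    ring

theorem one_add_pow_le_one_add_mul {x : ℝ} (h₀ : 0 ≤ x) (h₁ : x ≤ 1) (d : ℕ) :
    (1 + x) ^ d ≤ 1 + (2 ^ d - 1) * x := by
  induction d with
  | zero => simp
  | succ d ih =>
    have h2d : (1 : ℝ) ≤ 2 ^ d := one_le_pow₀ one_le_two
    calc (1 + x) ^ (d + 1) ≤ (1 + (2 ^ d - 1) * x) * (1 + x) := by rw [pow_succ]; gcongr
      _ ≤ 1 + (2 ^ (d + 1) - 1) * x := by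
        rw [pow_succ]
        nlinarith [mul_nonneg (mul_nonneg (sub_nonneg.2 h2d) h₀) (sub_nonneg.2 h₁)]

theorem div_add_two_pow_mul_pow_le {L n : ℝ} (hL : 1 ≤ L) (hn : L ≤ n) (d : ℕ) :
    L / (L + 2 ^ d) * n ^ d ≤ (n - 1 / 2) ^ d := by
  have hpos : 0 < n - 1 / 2 := by linarith
  set x := (2 * n - 1)⁻¹
  have hx : x ≤ L⁻¹ := inv_anti₀ (by linarith) (by linarith)
  have hn_eq : n = (n - 1 / 2) * (1 + x) := by
    have hx_mul : (2 * n - 1) * x = 1 := mul_inv_cancel₀ (by linarith)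
    linear_combination -hx_mul / 2
  have hpow : (1 + x) ^ d ≤ (L + 2 ^ d) / L := by
    have hx₀ : 0 ≤ x := inv_nonneg.2 (by linarith)
    have h2d : (0 : ℝ) < 2 ^ d := by positivity
    calc (1 + x) ^ d ≤ 1 + (2 ^ d - 1) * x :=
          one_add_pow_le_one_add_mul hx₀ (hx.trans (inv_le_one_of_one_le₀ hL)) d
      _ ≤ 1 + 2 ^ d * L⁻¹ := by nlinarith
      _ = (L + 2 ^ d) / L := by field_simp
  calc L / (L + 2 ^ d) * n ^ d = (n - 1 / 2) ^ d * (L / (L + 2 ^ d) * (1 + x) ^ d) := by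
        nth_rw 1 [hn_eq]
        rw [mul_pow]
        ring
    _ ≤ (n - 1 / 2) ^ d * (L / (L + 2 ^ d) * ((L + 2 ^ d) / L)) := by gcongr
    _ = (n - 1 / 2) ^ d := by field_simp

namespace DDGeometry

variable {d : ℕ} {G : DDGeometry d} {ψ : G.Cell → Fin (2 ^ d) → (Fin d → ℝ) → ℝ}

theorem setIntegral_cellSet_prod (K : G.Cell) (f : Fin d → ℝ → ℝ) :
    ∫ x in G.cellSet K, ∏ t, f t (x t) = ∏ t, ∫ x in
      Set.Ioo (((K t : ℕ) : ℝ) / 2 ^ G.L) ((((K t : ℕ) : ℝ) + 1) / 2 ^ G.L), f t x := by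
  rw [cellSet, volume_pi, Measure.restrict_pi_pi]
  exact integral_fintype_prod_eq_prod f

/-- The coefficients of the combination are `±1`, at the finest level of the first subdomain. -/
theorem exists_feGrad_localFactor_mulVec_eq {ε : Fin d → ℝ} (hε : ∀ t, ε t ^ 2 = 1) (s : Fin d) :
    ∃ z : G.Sub × BPXIndex d G.L → ℝ, ∑ c, z c ^ 2 = (2 ^ G.L - 1) ^ d ∧
      ∀ K, ∀ y ∈ G.cellSet K, G.feGrad (G.localFactor *ᵥ z) y s =
        bpxWeight d G.L * ∏ t, partialFactor s t (powSpline G.L (ε t)) (y t) := by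
  obtain ⟨l, hl⟩ := Nat.exists_eq_add_of_le' G.one_le_L
  let e : CubeVertex d (l + 1) → G.Sub × BPXIndex d G.L :=
    fun j => (fun t => ⟨0, G.one_le_N t⟩, ⟨⟨l, by omega⟩, j⟩)
  have he : Function.Injective e := fun j j' h => by simpa [e] using h
  let b : CubeVertex d (l + 1) → ℝ := fun j => ∏ t, ε t ^ (j t + 1 : ℕ)
  let z : G.Sub × BPXIndex d G.L → ℝ := Function.extend e b fun _ => 0
  have he_apply : ∀ j, z (e j) = b j := he.extend_apply b _
  have he_notMem : ∀ c ∉ Set.range e, z c = 0 := fun c hc => Function.extend_apply' b _ c hc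
  refine ⟨z, ?_, fun K y hy => ?_⟩
  · rw [← Fintype.sum_of_injective e he (fun j => b j ^ 2) _
      (fun c hc => by rw [he_notMem c hc, zero_pow two_ne_zero]) fun j => by rw [he_apply]]
    have hb : ∀ j, b j ^ 2 = 1 := fun j => by
      simp only [b, ← Finset.prod_pow, pow_right_comm _ _ 2, hε, one_pow, Finset.prod_const_one]
    simp [hb, hl, Nat.cast_sub Nat.one_le_two_pow]
  · rw [feGrad_mulVec, ← Fintype.sum_of_injective e he
      (fun j => b j * G.localDeriv s (e j) y) _
      (fun c hc => by rw [he_notMem c hc, zero_mul])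
      fun j => by rw [he_apply, feGrad_localFactor_col _ hy]]
    have hcell : ∀ t, y t ∈ Set.Ioo ((((K t : ℕ) : ℤ) : ℝ) / 2 ^ (l + 1))
        ((((K t : ℕ) : ℤ) + 1) / 2 ^ (l + 1)) := fun t => by
      simpa only [hl] using G.apply_mem_Ioo_of_mem_cellSet hy t
    rw [show powSpline G.L = powSpline (l + 1) by rw [hl]]
    simp only [partialFactor_powSpline s _ (ε _) (hcell _), Finset.prod_univ_sum,
      Fintype.piFinset_univ, Finset.prod_mul_distrib, Finset.mul_sum]
    refine Finset.sum_congr rfl fun j _ => ?_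
    simp only [b, e, localDeriv, nodalDeriv, offset, hl, zero_mul, Nat.cast_zero, zero_div,
      mul_zero, zero_add, Int.cast_natCast]
    ring

theorem le_bpxWeight_sq_mul_sum_integral_prod_sq (s : Fin d) :
    4 * ((2 : ℝ) ^ G.L - 3 / 2) ^ d ≤ bpxWeight d G.L ^ 2 * ∑ K, ∫ y in G.cellSet K,
      ∏ t, partialFactor s t (powSpline G.L (if t = s then -1 else 1)) (y t) ^ 2 := by
  have hL := Nat.one_le_iff_ne_zero.1 G.one_le_L
  have hpos : (0 : ℝ) ≤ 2 ^ G.L - 3 / 2 := by linarith [le_self_pow₀ one_le_two hL (a := (2 : ℝ))]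
  calc 4 * ((2 : ℝ) ^ G.L - 3 / 2) ^ d
      = bpxWeight d G.L ^ 2 * ∏ t,
          (if t = s then 4 * (2 ^ G.L) ^ 2 else 1) * ((2 ^ G.L - 3 / 2) * (2 ^ G.L)⁻¹) := by
        rw [Finset.prod_mul_distrib, Finset.prod_ite_eq' Finset.univ s fun _ => _,
          if_pos (Finset.mem_univ s), Finset.prod_const, Finset.card_univ, Fintype.card_fin,
          mul_pow]
        linear_combination -(4 * (2 ^ G.L - 3 / 2) ^ d) * bpxWeight_sq_mul d G.L
    _ ≤ bpxWeight d G.L ^ 2 * ∏ t, ∑ k : Fin (G.cells t),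
          ∫ x in Set.Ioo (((k : ℕ) : ℝ) / 2 ^ G.L) ((((k : ℕ) : ℝ) + 1) / 2 ^ G.L),
            partialFactor s t (powSpline G.L (if t = s then -1 else 1)) x ^ 2 := by
        gcongr with t
        exact le_sum_integral_sq_partialFactor_powSpline hL (Nat.le_add_right _ _) s t
    _ = _ := by
        simp only [Finset.prod_univ_sum, Fintype.piFinset_univ,
          setIntegral_cellSet_prod _ fun t x =>
            partialFactor s t (powSpline G.L (if t = s then -1 else 1)) x ^ 2]

theorem exists_le_sum_sq_gradMatrix_mul_localFactor_mulVec (h : G.IsDGBasis ψ) (s : Fin d) :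
    ∃ z : G.Sub × BPXIndex d G.L → ℝ, 0 < ∑ c, z c ^ 2 ∧
      4 * (G.L / (G.L + 2 ^ d)) * ∑ c, z c ^ 2 ≤
        ∑ r, ((G.gradMatrix ψ * G.localFactor) *ᵥ z) r ^ 2 := by
  have hL_le : (G.L : ℝ) ≤ 2 ^ G.L - 1 :=
    le_sub_iff_add_le.2 (by exact_mod_cast Nat.lt_two_pow_self)
  have one_le : (1 : ℝ) ≤ G.L := by exact_mod_cast G.one_le_L
  obtain ⟨z, hz, hfe⟩ := exists_feGrad_localFactor_mulVec_eq (G := G)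
    (ε := fun t => if t = s then -1 else 1) (fun t => by split_ifs <;> norm_num) s
  refine ⟨z, hz ▸ pow_pos (by linarith) d, ?_⟩
  rw [← Matrix.mulVec_mulVec, sum_sq_gradMatrix_mulVec h, hz]
  calc 4 * (G.L / (G.L + 2 ^ d)) * ((2 : ℝ) ^ G.L - 1) ^ d
      ≤ 4 * ((2 : ℝ) ^ G.L - 3 / 2) ^ d := by
        rw [mul_assoc, show (2 : ℝ) ^ G.L - 3 / 2 = 2 ^ G.L - 1 - 1 / 2 by ring]
        gcongr
        exact div_add_two_pow_mul_pow_le one_le hL_le d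
    _ ≤ _ := le_bpxWeight_sq_mul_sum_integral_prod_sq s
    _ = ∑ K, ∫ y in G.cellSet K, G.feGrad (G.localFactor *ᵥ z) y s ^ 2 := by
        rw [Finset.mul_sum]
        refine Finset.sum_congr rfl fun K _ => ?_
        rw [← integral_const_mul]
        refine setIntegral_congr_fun (G.measurableSet_cellSet K) fun y hy => ?_
        simp only [hfe K y hy, mul_pow, Finset.prod_pow]
    _ = ∫ y in G.Ω, G.feGrad (G.localFactor *ᵥ z) y s ^ 2 := by
        simp only [sq]
        exact (G.setIntegral_Ω fun K => integrableOn_feGrad_mul_feGrad _ _ K s s).symm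
    _ ≤ _ := Finset.single_le_sum (f := fun s => ∫ y in G.Ω, G.feGrad (G.localFactor *ᵥ z) y s ^ 2)
        (fun _ _ => integral_nonneg fun _ => sq_nonneg _) (Finset.mem_univ s)

end DDGeometry

/-! ### Spectral norms -/

section SpectralNorm

variable {𝕜 : Type*} [RCLike 𝕜] {m n o : Type*} [Fintype m] [Fintype n] [Fintype o]
  [DecidableEq n]

theorem sum_norm_sq_mulVec_le (A : Matrix m n 𝕜) (x : n → 𝕜) :
    ∑ i, ‖(A *ᵥ x) i‖ ^ 2 ≤ ‖A‖ ^ 2 * ∑ j, ‖x j‖ ^ 2 := by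
  have h := pow_le_pow_left₀ (norm_nonneg _) (Matrix.l2_opNorm_mulVec A (WithLp.toLp 2 x)) 2
  rwa [mul_pow, EuclideanSpace.norm_sq_eq, EuclideanSpace.norm_sq_eq] at h

theorem sum_sq_mulVec_le (A : Matrix m n ℝ) (x : n → ℝ) :
    ∑ i, (A *ᵥ x) i ^ 2 ≤ ‖A‖ ^ 2 * ∑ j, x j ^ 2 := by
  simpa only [Real.norm_eq_abs, sq_abs] using sum_norm_sq_mulVec_le A x

theorem norm_sq_le_of_sum_norm_sq_mulVec_le (A : Matrix m n 𝕜) {c : ℝ} (hc : 0 ≤ c)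
    (h : ∀ x, ∑ i, ‖(A *ᵥ x) i‖ ^ 2 ≤ c * ∑ j, ‖x j‖ ^ 2) : ‖A‖ ^ 2 ≤ c := by
  rw [← Real.le_sqrt (norm_nonneg _) hc, Matrix.l2_opNorm_def]
  refine ContinuousLinearMap.opNorm_le_bound _ (Real.sqrt_nonneg c) fun x => ?_
  refine le_of_sq_le_sq ?_ (by positivity)
  rw [mul_pow, Real.sq_sqrt hc, EuclideanSpace.norm_sq_eq, EuclideanSpace.norm_sq_eq]
  exact h x

theorem norm_sq_le_of_sum_sq_mulVec_le (A : Matrix m n ℝ) {c : ℝ} (hc : 0 ≤ c)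
    (h : ∀ x, ∑ i, (A *ᵥ x) i ^ 2 ≤ c * ∑ j, x j ^ 2) : ‖A‖ ^ 2 ≤ c :=
  norm_sq_le_of_sum_norm_sq_mulVec_le A hc
    (by simpa only [Real.norm_eq_abs, sq_abs] using h)

theorem norm_sq_eq_norm_conjTranspose_mul_self (A : Matrix m n 𝕜) : ‖A‖ ^ 2 = ‖Aᴴ * A‖ := by
  rw [Matrix.l2_opNorm_conjTranspose_mul_self, pow_two]

theorem norm_sq_eq_norm_mul_conjTranspose_self [DecidableEq m] (A : Matrix m n 𝕜) :
    ‖A‖ ^ 2 = ‖A * Aᴴ‖ := by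
  rw [← Matrix.l2_opNorm_conjTranspose, norm_sq_eq_norm_conjTranspose_mul_self,
    Matrix.conjTranspose_conjTranspose]

theorem norm_sq_fromCols_le [DecidableEq o] (A : Matrix m n 𝕜) (B : Matrix m o 𝕜) :
    ‖Matrix.fromCols A B‖ ^ 2 ≤ ‖A‖ ^ 2 + ‖B‖ ^ 2 := by
  classical
  rw [norm_sq_eq_norm_mul_conjTranspose_self, norm_sq_eq_norm_mul_conjTranspose_self A,
    norm_sq_eq_norm_mul_conjTranspose_self B,
    Matrix.conjTranspose_fromCols_eq_fromRows_conjTranspose, Matrix.fromCols_mul_fromRows]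
  exact norm_add_le _ _

theorem norm_kronecker_one_le [DecidableEq o] (A : Matrix m n 𝕜) :
    ‖A ⊗ₖ (1 : Matrix o o 𝕜)‖ ≤ ‖A‖ := by
  refine le_of_sq_le_sq (norm_sq_le_of_sum_norm_sq_mulVec_le _ (by positivity) fun x => ?_)
    (norm_nonneg _)
  have mulVec_apply : ∀ i k, ((A ⊗ₖ (1 : Matrix o o 𝕜)) *ᵥ x) (i, k) =
      (A *ᵥ fun j => x (j, k)) i := fun i k => by
    simp [Matrix.mulVec, dotProduct, Fintype.sum_prod_type, Matrix.one_apply]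
  simp_rw [Fintype.sum_prod_type_right, Finset.mul_sum, mulVec_apply]
  exact Finset.sum_le_sum fun k _ => by
    simpa only [Finset.mul_sum] using sum_norm_sq_mulVec_le A fun j => x (j, k)

theorem norm_toC (A : Matrix m n ℝ) : ‖toC A‖ = ‖A‖ := by
  refine le_antisymm (le_of_sq_le_sq (norm_sq_le_of_sum_norm_sq_mulVec_le _ (by positivity)
    fun x => ?_) (norm_nonneg _)) (le_of_sq_le_sq (norm_sq_le_of_sum_sq_mulVec_le _
    (by positivity) fun x => ?_) (norm_nonneg _))
  · have norm_sq_eq : ∀ z : ℂ, ‖z‖ ^ 2 = z.re ^ 2 + z.im ^ 2 := fun z => by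
      rw [Complex.sq_norm, Complex.normSq_apply, pow_two, pow_two]
    have re_mulVec : ∀ i, ((toC A *ᵥ x) i).re = (A *ᵥ fun j => (x j).re) i := fun i => by
      simp [toC, Matrix.mulVec, dotProduct]
    have im_mulVec : ∀ i, ((toC A *ᵥ x) i).im = (A *ᵥ fun j => (x j).im) i := fun i => by
      simp [toC, Matrix.mulVec, dotProduct]
    simp_rw [norm_sq_eq, re_mulVec, im_mulVec, Finset.sum_add_distrib, mul_add]
    exact add_le_add (sum_sq_mulVec_le _ _) (sum_sq_mulVec_le _ _)
  · have mulVec_ofReal : ∀ i, (toC A *ᵥ fun j => (x j : ℂ)) i = ((A *ᵥ x) i : ℝ) := fun i => by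
      simp [toC, Matrix.mulVec, dotProduct]
    simpa only [mulVec_ofReal, Complex.norm_real, Real.norm_eq_abs, sq_abs] using
      sum_norm_sq_mulVec_le (toC A) fun j => (x j : ℂ)

theorem toC_inv {A : Matrix n n ℝ} (hA : IsUnit A) : (toC A)⁻¹ = toC A⁻¹ := by
  refine Matrix.inv_eq_right_inv ?_
  have h := congrArg (Complex.ofRealHom.mapMatrix)
    (Matrix.mul_nonsing_inv A ((Matrix.isUnit_iff_isUnit_det A).1 hA))
  rwa [map_mul, map_one] at h

theorem condNumber_toC {A : Matrix n n ℝ} (hA : IsUnit A) :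
    condNumber (toC A) = ‖A‖ * ‖A⁻¹‖ := by
  rw [condNumber, toC_inv hA, norm_toC, norm_toC]

open scoped MatrixOrder ComplexOrder in
theorem norm_sq_le_norm_inv_mul_norm_conjTranspose_mul_mul [DecidableEq m] {E : Matrix m m 𝕜}
    (hE : E.PosDef) (X : Matrix m n 𝕜) : ‖X‖ ^ 2 ≤ ‖E⁻¹‖ * ‖Xᴴ * E * X‖ := by
  obtain ⟨B, rfl⟩ := CStarAlgebra.nonneg_iff_eq_star_mul_self.1 hE.posSemidef.nonneg
  rw [Matrix.star_eq_conjTranspose] at hE ⊢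
  have hB : IsUnit B.det := by
    have := (Matrix.isUnit_iff_isUnit_det _).1 hE.isUnit
    rw [Matrix.det_mul] at this
    exact isUnit_of_mul_isUnit_right this
  have norm_inv : ‖(Bᴴ * B)⁻¹‖ = ‖B⁻¹‖ ^ 2 := by
    rw [Matrix.mul_inv_rev, ← Matrix.conjTranspose_nonsing_inv,
      norm_sq_eq_norm_mul_conjTranspose_self]
  have norm_conj : ‖Xᴴ * (Bᴴ * B) * X‖ = ‖B * X‖ ^ 2 := by
    rw [norm_sq_eq_norm_conjTranspose_mul_self, Matrix.conjTranspose_mul]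
    simp only [Matrix.mul_assoc]
  rw [norm_inv, norm_conj, ← mul_pow]
  gcongr
  calc ‖X‖ = ‖B⁻¹ * (B * X)‖ := by
        rw [← Matrix.mul_assoc, Matrix.nonsing_inv_mul _ hB, Matrix.one_mul]
    _ ≤ ‖B⁻¹‖ * ‖B * X‖ := Matrix.l2_opNorm_mul _ _

theorem norm_conjTranspose_mul_mul_le [DecidableEq m] (E : Matrix m m 𝕜) (X : Matrix m n 𝕜) :
    ‖Xᴴ * E * X‖ ≤ ‖E‖ * ‖X‖ ^ 2 := by
  refine (Matrix.l2_opNorm_mul _ _).trans ?_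
  grw [Matrix.l2_opNorm_mul, Matrix.l2_opNorm_conjTranspose]
  exact le_of_eq (by ring)

end SpectralNorm

theorem isHermitian_toC {n : Type*} {A : Matrix n n ℝ} (hA : A.IsHermitian) :
    (toC A).IsHermitian :=
  hA.map Complex.ofReal fun x => (Complex.conj_ofReal x).symm

open scoped ComplexOrder in
theorem posDef_blockDiagonal {𝕜 n o : Type*} [RCLike 𝕜] [Finite n] [Finite o] [DecidableEq o]
    {D : o → Matrix n n 𝕜} (hD : ∀ k, (D k).PosDef) : (Matrix.blockDiagonal D).PosDef := by
  have := Fintype.ofFinite n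
  have := Fintype.ofFinite o
  refine Matrix.posDef_iff_dotProduct_mulVec.2 ⟨?_, fun {x} hx => ?_⟩
  · rw [Matrix.IsHermitian, Matrix.blockDiagonal_conjTranspose]
    exact congrArg _ (funext fun k => (hD k).isHermitian)
  · have mulVec_apply : ∀ i k, (Matrix.blockDiagonal D *ᵥ x) (i, k) =
        (D k *ᵥ fun j => x (j, k)) i := fun i k => by
      simp [Matrix.mulVec, dotProduct, Fintype.sum_prod_type, Matrix.blockDiagonal_apply]
    have dotProduct_eq : star x ⬝ᵥ (Matrix.blockDiagonal D *ᵥ x) =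
        ∑ k, star (fun j => x (j, k)) ⬝ᵥ (D k *ᵥ fun j => x (j, k)) := by
      simp_rw [dotProduct, Fintype.sum_prod_type_right, mulVec_apply, Pi.star_apply]
    obtain ⟨⟨j, k⟩, hjk⟩ := Function.ne_iff.1 hx
    rw [dotProduct_eq]
    exact Finset.sum_pos' (fun k _ => (hD k).posSemidef.dotProduct_mulVec_nonneg _)
      ⟨k, Finset.mem_univ k, (hD k).dotProduct_mulVec_pos (Function.ne_iff.2 ⟨j, hjk⟩)⟩

/-! ### The preconditioned matrix -/

namespace DDGeometry

variable {d : ℕ} {G : DDGeometry d} {ψ : G.Cell → Fin (2 ^ d) → (Fin d → ℝ) → ℝ} {k q : ℕ}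

section SchwarzFactor

variable (Z : Matrix G.Vertex (Fin k) ℝ) (F₀ : Matrix (Fin k) (Fin q) ℝ)

theorem gradMatrix_mul_schwarzFactor : G.gradMatrix ψ * G.schwarzFactor Z F₀ =
    Matrix.fromCols (G.gradMatrix ψ * G.localFactor) (G.gradMatrix ψ * Z * F₀) := by
  rw [Matrix.mul_assoc, ← Matrix.mul_fromCols]
  rfl

theorem norm_sq_gradMatrix_mul_schwarzFactor_le (h : G.IsDGBasis ψ) :
    ‖G.gradMatrix ψ * G.schwarzFactor Z F₀‖ ^ 2 ≤
      4 * G.numSub * d * G.L + ‖G.gradMatrix ψ * Z * F₀‖ ^ 2 := by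
  rw [gradMatrix_mul_schwarzFactor]
  grw [norm_sq_fromCols_le, norm_sq_le_of_sum_sq_mulVec_le (G.gradMatrix ψ * G.localFactor)
    (by positivity) (sum_sq_gradMatrix_mul_localFactor_mulVec_le h)]

theorem norm_sq_gradMatrix_mul_coarse_le : ‖G.gradMatrix ψ * Z * F₀‖ ^ 2 ≤
    ‖G.gradMatrix ψ * G.schwarzFactor Z F₀‖ ^ 2 := by
  refine norm_sq_le_of_sum_sq_mulVec_le _ (by positivity) fun x => ?_
  simpa [gradMatrix_mul_schwarzFactor, Matrix.fromCols_mulVec_sumElim] using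
    sum_sq_mulVec_le (G.gradMatrix ψ * G.schwarzFactor Z F₀) (Sum.elim 0 x)

theorem le_norm_sq_gradMatrix_mul_schwarzFactor (h : G.IsDGBasis ψ) (s : Fin d) :
    4 * (G.L / (G.L + 2 ^ d)) ≤ ‖G.gradMatrix ψ * G.schwarzFactor Z F₀‖ ^ 2 := by
  obtain ⟨z, hz, hle⟩ := exists_le_sum_sq_gradMatrix_mul_localFactor_mulVec h s
  refine le_of_mul_le_mul_right (hle.trans ?_) hz
  simpa [gradMatrix_mul_schwarzFactor, Matrix.fromCols_mulVec_sumElim] using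
    sum_sq_mulVec_le (G.gradMatrix ψ * G.schwarzFactor Z F₀) (Sum.elim z 0)

end SchwarzFactor

variable {ρ : (Fin d → ℝ) → Matrix (Fin d) (Fin d) ℝ} {ρK : G.Cell → Matrix (Fin d) (Fin d) ℝ}

theorem posDef_coeffMatrix (hpos : ∀ K, (ρK K).PosDef) : (G.coeffMatrix ρK).PosDef :=
  posDef_blockDiagonal hpos

theorem coeffMatrix_ne_zero (hpos : ∀ K, (ρK K).PosDef) (r : Fin d × G.Cell) :
    G.coeffMatrix ρK ≠ 0 := fun h => by
  simpa [h] using (posDef_coeffMatrix hpos).diag_pos (i := r)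

theorem posDef_coeffMatrix_kronecker_one (hpos : ∀ K, (ρK K).PosDef) :
    (G.coeffMatrix ρK ⊗ₖ (1 : Matrix (Fin (2 ^ d)) (Fin (2 ^ d)) ℝ)).PosDef :=
  (posDef_coeffMatrix hpos).kronecker Matrix.PosDef.one

theorem stiffness_eq_conjTranspose_mul_mul (h : G.IsDGBasis ψ)
    (hρ : ∀ K, ∀ x ∈ G.cellSet K, ρ x = ρK K) (hpos : ∀ K, (ρK K).PosDef) :
    G.stiffness ρ = (G.gradMatrix ψ)ᴴ *
      (G.coeffMatrix ρK ⊗ₖ (1 : Matrix (Fin (2 ^ d)) (Fin (2 ^ d)) ℝ)) * G.gradMatrix ψ := by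
  rw [stiffness_eq_transpose_mul_mul h hρ, Matrix.conjTranspose_eq_transpose_of_trivial,
    ← Matrix.conjTranspose_eq_transpose_of_trivial (G.coeffMatrix ρK),
    (posDef_coeffMatrix hpos).isHermitian.eq]

theorem posDef_stiffness (h : G.IsDGBasis ψ) (hρ : ∀ K, ∀ x ∈ G.cellSet K, ρ x = ρK K)
    (hpos : ∀ K, (ρK K).PosDef) (s : Fin d) : (G.stiffness ρ).PosDef := by
  rw [stiffness_eq_conjTranspose_mul_mul h hρ hpos]
  exact (posDef_coeffMatrix_kronecker_one hpos).conjTranspose_mul_mul_same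
    (gradMatrix_mulVec_injective h s)

theorem transpose_mul_stiffness_mul (h : G.IsDGBasis ψ)
    (hρ : ∀ K, ∀ x ∈ G.cellSet K, ρ x = ρK K) (hpos : ∀ K, (ρK K).PosDef) {n : Type*}
    (F : Matrix G.Vertex n ℝ) :
    Fᵀ * G.stiffness ρ * F = (G.gradMatrix ψ * F)ᴴ *
      (G.coeffMatrix ρK ⊗ₖ (1 : Matrix (Fin (2 ^ d)) (Fin (2 ^ d)) ℝ)) *
        (G.gradMatrix ψ * F) := by
  rw [stiffness_eq_conjTranspose_mul_mul h hρ hpos, Matrix.conjTranspose_mul,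
    Matrix.conjTranspose_eq_transpose_of_trivial F]
  simp only [Matrix.mul_assoc]

section Conjugation

variable {n : Type*}

theorem isHermitian_transpose_mul_stiffness_mul (h : G.IsDGBasis ψ)
    (hρ : ∀ K, ∀ x ∈ G.cellSet K, ρ x = ρK K) (hpos : ∀ K, (ρK K).PosDef)
    (F : Matrix G.Vertex n ℝ) : (Fᵀ * G.stiffness ρ * F).IsHermitian := by
  rw [transpose_mul_stiffness_mul h hρ hpos]
  exact Matrix.isHermitian_conjTranspose_mul_mul _
    (posDef_coeffMatrix_kronecker_one hpos).isHermitian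

variable [Fintype n] [DecidableEq n]

theorem norm_transpose_mul_stiffness_mul_le (h : G.IsDGBasis ψ)
    (hρ : ∀ K, ∀ x ∈ G.cellSet K, ρ x = ρK K) (hpos : ∀ K, (ρK K).PosDef)
    (F : Matrix G.Vertex n ℝ) :
    ‖Fᵀ * G.stiffness ρ * F‖ ≤ ‖G.coeffMatrix ρK‖ * ‖G.gradMatrix ψ * F‖ ^ 2 := by
  rw [transpose_mul_stiffness_mul h hρ hpos]
  grw [norm_conjTranspose_mul_mul_le, norm_kronecker_one_le]

theorem norm_sq_gradMatrix_mul_le (h : G.IsDGBasis ψ) (hρ : ∀ K, ∀ x ∈ G.cellSet K, ρ x = ρK K)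
    (hpos : ∀ K, (ρK K).PosDef) (F : Matrix G.Vertex n ℝ) :
    ‖G.gradMatrix ψ * F‖ ^ 2 ≤ ‖(G.coeffMatrix ρK)⁻¹‖ * ‖Fᵀ * G.stiffness ρ * F‖ := by
  rw [transpose_mul_stiffness_mul h hρ hpos]
  refine (norm_sq_le_norm_inv_mul_norm_conjTranspose_mul_mul
    (posDef_coeffMatrix_kronecker_one hpos) (G.gradMatrix ψ * F)).trans ?_
  rw [Matrix.inv_kronecker, inv_one]
  grw [norm_kronecker_one_le]

end Conjugation

variable {Z : Matrix G.Vertex (Fin k) ℝ} {F₀ : Matrix (Fin k) (Fin q) ℝ}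

theorem norm_preconditioned_le (h : G.IsDGBasis ψ) (hρ : ∀ K, ∀ x ∈ G.cellSet K, ρ x = ρK K)
    (hpos : ∀ K, (ρK K).PosDef) :
    ‖(G.schwarzFactor Z F₀)ᵀ * G.stiffness ρ * G.schwarzFactor Z F₀‖ ≤
      ‖G.coeffMatrix ρK‖ * (4 * G.numSub * d * G.L + ‖G.gradMatrix ψ * Z * F₀‖ ^ 2) := by
  grw [norm_transpose_mul_stiffness_mul_le h hρ hpos,
    norm_sq_gradMatrix_mul_schwarzFactor_le Z F₀ h]

theorem four_mul_add_sq_le_mul_norm_preconditioned (h : G.IsDGBasis ψ)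
    (hρ : ∀ K, ∀ x ∈ G.cellSet K, ρ x = ρK K) (hpos : ∀ K, (ρK K).PosDef) (s : Fin d) (σ : ℝ) :
    4 * G.numSub * d * G.L + (σ * ‖G.gradMatrix ψ * Z * F₀‖) ^ 2 ≤
      (G.numSub * d * (G.L + 2 ^ d) + σ ^ 2) * (‖(G.coeffMatrix ρK)⁻¹‖ *
        ‖(G.schwarzFactor Z F₀)ᵀ * G.stiffness ρ * G.schwarzFactor Z F₀‖) := by
  have hlocal : (4 * G.numSub * d * G.L : ℝ) ≤ G.numSub * d * (G.L + 2 ^ d) *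
      ‖G.gradMatrix ψ * G.schwarzFactor Z F₀‖ ^ 2 := by
    grw [← le_norm_sq_gradMatrix_mul_schwarzFactor Z F₀ h s]
    field_simp
    exact le_rfl
  grw [← norm_sq_gradMatrix_mul_le h hρ hpos, hlocal, mul_pow, norm_sq_gradMatrix_mul_coarse_le,
    add_mul]

theorem gradMatrix_mul_coarse_ne_zero (h : G.IsDGBasis ψ)
    (hρ : ∀ K, ∀ x ∈ G.cellSet K, ρ x = ρK K) (hpos : ∀ K, (ρK K).PosDef) (s : Fin d)
    (hk : 1 ≤ k) (hZ : LinearIndependent ℝ Z.col) (hF : (Zᵀ * G.stiffness ρ * Z)⁻¹ = F₀ * F₀ᵀ) :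
    G.gradMatrix ψ * Z * F₀ ≠ 0 := by
  intro h0
  have F₀_eq_zero : F₀ = 0 := by
    have hinj : Function.Injective (G.gradMatrix ψ * Z).mulVec := by
      have := (gradMatrix_mulVec_injective h s).comp (Matrix.mulVec_injective_iff.2 hZ)
      simpa only [Function.comp_def, Matrix.mulVec_mulVec] using this
    ext i j
    have hcol : (G.gradMatrix ψ * Z) *ᵥ F₀.col j = (G.gradMatrix ψ * Z) *ᵥ 0 := by
      rw [Matrix.mulVec_zero]
      exact congrArg (Matrix.col · j) h0
    exact congrFun (hinj hcol) i
  have hcoarse : (Zᵀ * G.stiffness ρ * Z)⁻¹.PosDef :=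
    ((posDef_stiffness h hρ hpos s).conjTranspose_mul_mul_same
      (Matrix.mulVec_injective_iff.2 hZ)).inv
  have := hcoarse.diag_pos (i := ⟨0, hk⟩)
  rw [hF, F₀_eq_zero, Matrix.zero_mul] at this
  exact this.ne rfl

end DDGeometry

/-! ### Block-encodings by unitary dilation -/

section Dilation

variable {n : Type*} [Fintype n] [DecidableEq n]

open scoped MatrixOrder ComplexOrder in
theorem exists_eq_smul_add_conjTranspose {T : Matrix n n ℂ} (hT : T.IsHermitian)
    (hT₁ : ‖T‖ ≤ 1) : ∃ u ∈ Matrix.unitaryGroup n ℂ, T = (2⁻¹ : ℂ) • (u + uᴴ) := by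
  let T' : selfAdjoint (Matrix n n ℂ) := ⟨T, hT⟩
  have hT' : ‖T'‖ ≤ 1 := hT₁
  refine ⟨selfAdjoint.unitarySelfAddISMul T' hT', SetLike.coe_mem _, ?_⟩
  rw [← Matrix.star_eq_conjTranspose, selfAdjoint.star_coe_unitarySelfAddISMul,
    selfAdjoint.unitarySelfAddISMul_coe, add_add_sub_cancel, ← two_smul ℂ, inv_smul_smul₀]
  exact two_ne_zero

theorem exists_fromBlocks_mem_unitaryGroup {T : Matrix n n ℂ} (hT : T.IsHermitian)
    (hT₁ : ‖T‖ ≤ 1) :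
    ∃ Q : Matrix n n ℂ, Matrix.fromBlocks T Q Q T ∈ Matrix.unitaryGroup (n ⊕ n) ℂ := by
  obtain ⟨u, hu, hT_eq⟩ := exists_eq_smul_add_conjTranspose hT hT₁
  have hu₁ : u * uᴴ = 1 := Matrix.mem_unitaryGroup_iff.1 hu
  have hu₂ : uᴴ * u = 1 := Matrix.mem_unitaryGroup_iff'.1 hu
  refine ⟨(2⁻¹ : ℂ) • (u - uᴴ), Matrix.mem_unitaryGroup_iff.2 ?_⟩
  rw [Matrix.star_eq_conjTranspose, Matrix.fromBlocks_conjTranspose, hT.eq,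
    Matrix.fromBlocks_multiply, ← Matrix.fromBlocks_one, hT_eq]
  have hstar : ((2⁻¹ : ℂ) • (u - uᴴ))ᴴ = (2⁻¹ : ℂ) • (uᴴ - u) := by simp
  rw [hstar]
  simp only [smul_mul_smul_comm, ← smul_add, mul_add, add_mul, mul_sub, sub_mul, hu₁, hu₂]
  congr 1 <;> module

theorem submatrix_one_mul_mul_submatrix_one_conjTranspose {R m n P : Type*} [Semiring R]
    [StarRing R] [Fintype P] [DecidableEq P] (f : m → P) (g : n → P) (A : Matrix P P R) :
    (1 : Matrix P P R).submatrix f id * A * ((1 : Matrix P P R).submatrix g id)ᴴ =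
      A.submatrix f g := by
  ext i j
  simp [Matrix.mul_apply, Matrix.one_apply]

theorem submatrix_one_mul_conjTranspose_self {R m P : Type*} [Semiring R] [StarRing R]
    [Fintype P] [DecidableEq m] [DecidableEq P] (f : m ↪ P) :
    (1 : Matrix P P R).submatrix f id * ((1 : Matrix P P R).submatrix f id)ᴴ = 1 := by
  simpa only [Matrix.mul_one, Matrix.submatrix_one f f.injective] using
    submatrix_one_mul_mul_submatrix_one_conjTranspose f f (1 : Matrix P P R)

theorem fromBlocks_one_mem_unitaryGroup {m n : Type*} [Fintype m] [Fintype n] [DecidableEq m]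
    [DecidableEq n] {W : Matrix m m ℂ} (hW : W ∈ Matrix.unitaryGroup m ℂ) :
    Matrix.fromBlocks W 0 0 (1 : Matrix n n ℂ) ∈ Matrix.unitaryGroup (m ⊕ n) ℂ := by
  rw [Matrix.mem_unitaryGroup_iff, Matrix.star_eq_conjTranspose] at hW ⊢
  simp [Matrix.fromBlocks_conjTranspose, Matrix.fromBlocks_multiply, hW]

theorem submatrix_equiv_mem_unitaryGroup {m n : Type*} [Fintype m] [Fintype n] [DecidableEq m]
    [DecidableEq n] (e : m ≃ n) {W : Matrix n n ℂ} (hW : W ∈ Matrix.unitaryGroup n ℂ) :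
    W.submatrix e e ∈ Matrix.unitaryGroup m ℂ := by
  rw [Matrix.mem_unitaryGroup_iff, Matrix.star_eq_conjTranspose] at hW ⊢
  rw [Matrix.conjTranspose_submatrix, Matrix.submatrix_mul_equiv, hW, Matrix.submatrix_one_equiv]

theorem exists_unitary_two_pow {P : Type*} [Fintype P] [DecidableEq P] {W : Matrix P P ℂ}
    (hW : W ∈ Matrix.unitaryGroup P ℂ) :
    ∃ (p : ℕ) (U : Matrix (Fin (2 ^ p)) (Fin (2 ^ p)) ℂ) (ι : P ↪ Fin (2 ^ p)),
      U ∈ Matrix.unitaryGroup (Fin (2 ^ p)) ℂ ∧ U.submatrix ι ι = W := by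
  set p := Fintype.card P
  have hp : p ≤ 2 ^ p := Nat.lt_two_pow_self.le
  have hcard : Fintype.card (Fin (2 ^ p)) = Fintype.card (P ⊕ Fin (2 ^ p - p)) := by
    rw [Fintype.card_sum, Fintype.card_fin, Fintype.card_fin, Nat.add_sub_of_le hp]
  let e := Fintype.equivOfCardEq hcard
  refine ⟨p, (Matrix.fromBlocks W 0 0 1).submatrix e e,
    Function.Embedding.inl.trans e.symm.toEmbedding,
    submatrix_equiv_mem_unitaryGroup e (fromBlocks_one_mem_unitaryGroup hW), ?_⟩
  ext i j
  simp

end Dilation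

namespace BlockEncoding

variable {m n : Type*} [Fintype m] [DecidableEq m] [Fintype n] [DecidableEq n]

theorem exists_of_unitary {P : Type*} [Fintype P] [DecidableEq P] {W : Matrix P P ℂ}
    (hW : W ∈ Matrix.unitaryGroup P ℂ) (f : m ↪ P) (g : n ↪ P) {M : Matrix m n ℂ} {α : ℝ}
    (hα : ‖M‖ ≤ α) (hM : M = (α : ℂ) • W.submatrix f g) : ∃ E : BlockEncoding M, E.α = α := by
  obtain ⟨p, U, ι, hU, hUW⟩ := exists_unitary_two_pow hW
  refine ⟨{
    p := p
    U := U
    α := α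
    rowProj := (1 : Matrix (Fin (2 ^ p)) (Fin (2 ^ p)) ℂ).submatrix (f.trans ι) id
    colProj := (1 : Matrix (Fin (2 ^ p)) (Fin (2 ^ p)) ℂ).submatrix (g.trans ι) id
    rowNOT := _
    colNOT := _
    unitary := hU
    rowProj_orthonormal := submatrix_one_mul_conjTranspose_self _
    colProj_orthonormal := submatrix_one_mul_conjTranspose_self _
    rowNOT_eq := rfl
    colNOT_eq := rfl
    norm_le := hα
    encodes := ?_ }, rfl⟩
  rw [submatrix_one_mul_mul_submatrix_one_conjTranspose, hM, ← hUW]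
  rfl

theorem exists_of_isHermitian {M : Matrix n n ℂ} (hM : M.IsHermitian) {α : ℝ} (hα : ‖M‖ ≤ α) :
    ∃ E : BlockEncoding M, E.α = α := by
  have hα₀ : 0 ≤ α := (norm_nonneg _).trans hα
  have hT : (α⁻¹ • M).IsHermitian := by
    rw [Matrix.IsHermitian, Matrix.conjTranspose_smul, hM.eq, star_trivial]
  have hT₁ : ‖α⁻¹ • M‖ ≤ 1 := by
    rw [norm_smul, Real.norm_of_nonneg (inv_nonneg.2 hα₀)]
    exact inv_mul_le_one_of_le₀ hα hα₀
  have hαT : M = (α : ℂ) • α⁻¹ • M := by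
    rcases eq_or_ne α 0 with rfl | hα_ne
    · simpa using hα
    · rw [Complex.coe_smul, smul_inv_smul₀ hα_ne]
  obtain ⟨Q, hW⟩ := exists_fromBlocks_mem_unitaryGroup hT hT₁
  exact exists_of_unitary hW Function.Embedding.inl Function.Embedding.inl hα hαT

variable {M : Matrix m n ℂ}

theorem α_nonneg (E : BlockEncoding M) : 0 ≤ E.α := (norm_nonneg M).trans E.norm_le

theorem subnorm_nonneg (E : BlockEncoding M) : 0 ≤ E.subnorm :=
  div_nonneg E.α_nonneg (norm_nonneg M)

theorem subnorm_mul_norm (hM : M ≠ 0) (E : BlockEncoding M) : E.subnorm * ‖M‖ = E.α :=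
  div_mul_cancel₀ _ (norm_ne_zero_iff.2 hM)

theorem subnorm_mul_norm_of_toC {A : Matrix m n ℝ} (hA : A ≠ 0)
    (E : BlockEncoding (toC A)) : E.subnorm * ‖A‖ = E.α := by
  have hne : toC A ≠ 0 := norm_ne_zero_iff.1 (by rwa [norm_toC, norm_ne_zero_iff])
  rw [← norm_toC, E.subnorm_mul_norm hne]

end BlockEncoding

end

theorem mainTheorem4_general {d : ℕ} (G : DDGeometry d)
    (ρ : (Fin d → ℝ) → Matrix (Fin d) (Fin d) ℝ) (ρK : G.Cell → Matrix (Fin d) (Fin d) ℝ)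
    (hρ : ∀ K, ∀ x ∈ G.cellSet K, ρ x = ρK K) (hpos : ∀ K, (ρK K).PosDef)
    (ψ : G.Cell → Fin (2 ^ d) → (Fin d → ℝ) → ℝ) (hψ : G.IsDGBasis ψ) {k q : ℕ}
    (Z : Matrix G.Vertex (Fin k) ℝ) (F₀ : Matrix (Fin k) (Fin q) ℝ)
    (hne : G.gradMatrix ψ * Z * F₀ ≠ 0) (UD : BlockEncoding (toC (G.coeffMatrix ρK)))
    (UZ : BlockEncoding (toC (G.gradMatrix ψ * Z * F₀))) :
    ∃ U : BlockEncoding (toC ((G.schwarzFactor Z F₀)ᵀ * G.stiffness ρ * G.schwarzFactor Z F₀)),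
      U.α = UD.α * (4 * G.numSub * d * G.L + UZ.α ^ 2) ∧
      U.subnorm ≤ condNumber (toC (G.coeffMatrix ρK)) * UD.subnorm *
        (G.numSub * d * (G.L + 2 ^ d) + UZ.subnorm ^ 2) := by
  obtain ⟨⟨⟨s, K⟩, _⟩, _⟩ := Function.ne_iff.1 hne
  have hUD := UD.subnorm_mul_norm_of_toC (DDGeometry.coeffMatrix_ne_zero hpos (s, K))
  have hUZ := UZ.subnorm_mul_norm_of_toC hne
  have hα := UD.α_nonneg
  have norm_le_α : ‖toC ((G.schwarzFactor Z F₀)ᵀ * G.stiffness ρ * G.schwarzFactor Z F₀)‖ ≤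
      UD.α * (4 * G.numSub * d * G.L + UZ.α ^ 2) := by
    rw [norm_toC]
    grw [DDGeometry.norm_preconditioned_le hψ hρ hpos, ← norm_toC, UD.norm_le, ← norm_toC,
      UZ.norm_le]
  obtain ⟨U, hU⟩ := BlockEncoding.exists_of_isHermitian
    (isHermitian_toC (DDGeometry.isHermitian_transpose_mul_stiffness_mul hψ hρ hpos _)) norm_le_α
  refine ⟨U, hU, ?_⟩
  rw [BlockEncoding.subnorm, hU, norm_toC,
    condNumber_toC (DDGeometry.posDef_coeffMatrix hpos).isUnit]
  refine div_le_of_le_mul₀ (norm_nonneg _) (mul_nonneg (mul_nonneg (by positivity)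
    UD.subnorm_nonneg) (by positivity)) ?_
  grw [← hUZ, DDGeometry.four_mul_add_sq_le_mul_norm_preconditioned hψ hρ hpos s]
  exact le_of_eq (by rw [← hUD]; ring)

theorem mainTheorem4 (d : ℕ) (hd : 1 ≤ d) :
    ∃ Cd : ℝ, ∀ (G : DDGeometry d)
      -- the diffusion coefficient, with the value `ρK K` on the element `K`
      (ρ : (Fin d → ℝ) → Matrix (Fin d) (Fin d) ℝ)
      (ρK : G.Cell → Matrix (Fin d) (Fin d) ℝ)
      (_ : ∀ K, ∀ x ∈ G.cellSet K, ρ x = ρK K)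
      (_ : ∀ K, (ρK K).PosDef)
      -- the orthonormal bases of the discontinuous space
      (ψ : G.Cell → Fin (2 ^ d) → (Fin d → ℝ) → ℝ) (_ : G.IsDGBasis ψ)
      -- a basis of the coarse space, and a factorization of the coarse solve
      (k q : ℕ) (_ : 1 ≤ k)
      (Z : Matrix G.Vertex (Fin k) ℝ) (_ : LinearIndependent ℝ Z.col)
      (F₀ : Matrix (Fin k) (Fin q) ℝ)
      (_ : (Zᵀ * G.stiffness ρ * Z)⁻¹ = F₀ * F₀ᵀ)
      (UD : BlockEncoding (toC (G.coeffMatrix ρK)))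
      (UZ : BlockEncoding (toC (G.gradMatrix ψ * Z * F₀))),
      ∃ U : BlockEncoding
          (toC ((G.schwarzFactor Z F₀)ᵀ * G.stiffness ρ * G.schwarzFactor Z F₀)),
        U.α = UD.α * (4 * G.numSub * d * G.L + UZ.α ^ 2) ∧
        U.subnorm ≤ condNumber (toC (G.coeffMatrix ρK)) * UD.subnorm *
          (G.numSub * d * (G.L + Cd) + UZ.subnorm ^ 2) :=
  ⟨2 ^ d, fun G ρ ρK hρ hpos ψ hψ _ _ hk Z hZ F₀ hF =>
    mainTheorem4_general G ρ ρK hρ hpos ψ hψ Z F₀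
      (DDGeometry.gradMatrix_mul_coarse_ne_zero hψ hρ hpos ⟨0, hd⟩ hk hZ hF)⟩
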